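/- **Theorem 2.2.** Let $\Omega$ be the set of all $\omega=(m,k,l;n,r,t)$ with $m,n\in\mathbb{Z}_+$ and $k,l,r,t\in\mathbb{Z}$, and let $u=\{u_{m,k,l;n,r,t}\}_{(m,k,l;n,r,t)\in\Omega}$ be a family of complex numbers. The extended two-dimensional moment problem for $u$ is to find a non-negative Borel measure $\mu$ on $\mathbb{R}^2$ such that $$\int_{\mathbb{R}^2} x_1^m (x_1+i)^k (x_1-i)^l\, x_2^n (x_2+i)^r (x_2-i)^t \, d\mu = u_{m,k,l;n,r,t}\qquad\text{for all } (m,k,l;n,r,t)\in\Omega, \tag{2.1}$$ all integrals being absolutely convergent. For $\omega=(m,k,l;n,r,t)$ and $\omega'=(m',k',l';n',r',t')$ in $\Omega$ put $\omega*\omega'=(m+m',k+l',l+k';n+n',r+t',t+r')$. (a) The problem has a solution if and only if both of the following hold: * for all families of complex numbers $\{\alpha_\omega\}_{\omega\in\Omega}$ with all but finitely many $\alpha_\omega$ equal to zero, $$\sum_{\omega,\omega'\in\Omega}\alpha_{\omega}\,\overline{\alpha_{\omega'}}\;u_{\omega*\omega'}\ \ge 0 ; \tag{2.2}$$ * for all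 $(m,k,l;n,r,t),(a,b,c;d,e,f)\in\Omega$, $$u_{m+1+a,k+c,l+b;n+d,r+f,t+e}+i\,u_{m+a,k+c,l+b;n+d,r+f,t+e}=u_{m+a,k+1+c,l+b;n+d,r+f,t+e},\tag{2.8}$$ $$u_{m+1+a,k+c,l+b;n+d,r+f,t+e}-i\,u_{m+a,k+c,l+b;n+d,r+f,t+e}=u_{m+a,k+c,l+1+b;n+d,r+f,t+e},\tag{2.9}$$ $$u_{m+a,k+c,l+b;n+1+d,r+f,t+e}+i\,u_{m+a,k+c,l+b;n+d,r+f,t+e}=u_{m+a,k+c,l+b;n+d,r+1+f,t+e},\tag{2.10}$$ $$u_{m+a,k+c,l+b;n+1+d,r+f,t+e}-i\,u_{m+a,k+c,l+b;n+d,r+f,t+e}=u_{m+a,k+c,l+b;n+d,r+f,t+1+e}.\tag{2.11}$$ (b) If these conditions hold, then the solution $\mu$ is unique and is constructed as follows. There exist a separable Hilbert space $H$ and a family $\{x_\omega\}_{\omega\in\Omega}$ in $H$ with dense linear span $L$ such that $(x_\omega,x_{\omega'})_H=u_{\omega*\omega'}$ for all $\omega,\omega'\in\Omega$. For every such $H$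 and $\{x_\omega\}$, the linear operators $A_0,B_0$ with domain $L$ given by $$A_0\sum\alpha_{m,k,l;n,r,t}\,x_{m,k,l;n,r,t}=\sum\alpha_{m,k,l;n,r,t}\,x_{m+1,k,l;n,r,t},\qquad B_0\sum\alpha_{m,k,l;n,r,t}\,x_{m,k,l;n,r,t}=\sum\alpha_{m,k,l;n,r,t}\,x_{m,k,l;n+1,r,t}$$ (finite sums) are well defined and essentially self-adjoint. Their closures $A=\overline{A_0}$ and $B=\overline{B_0}$ commute (their resolvents at non-real points commute), and there exists an orthogonal (projection-valued) spectral measure $E$ on the Borel subsets of $\mathbb{R}^2$ with $$A=\int_{\mathbb{R}^2}x_1\,dE(x),\qquad B=\int_{\mathbb{R}^2}x_2\,dE(x).$$ For every such $E$, the unique solution of the moment problem is $$\mu(\Delta)=(E(\Delta)x_{0,0,0;0,0,0},\,x_{0,0,0;0,0,0})_H,\qquad \Delta\subseteq\mathbb{R}^2\ \text{Borel}.\tag{2.34}$$ -/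

import Mathlib

open MeasureTheory
open scoped ComplexOrder

namespace ExtMoment

/-- The index set `Ω` of all `(m, k, l; n, r, t)` with `m, n` non-negative integers and
`k, l, r, t` integers. -/
@[ext]
structure Index where
  m : ℕ
  k : ℤ
  l : ℤ
  n : ℕ
  r : ℤ
  t : ℤ

namespace Index

/-- The index `(0, 0, 0; 0, 0, 0)`. -/
def zero : Index := ⟨0, 0, 0, 0, 0, 0⟩

def succM (w : Index) : Index := { w with m := w.m + 1 }
def succK (w : Index) : Index := { w with k := w.k + 1 }
def succL (w : Index) : Index := { w with l := w.l + 1 }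
def succN (w : Index) : Index := { w with n := w.n + 1 }
def succR (w : Index) : Index := { w with r := w.r + 1 }
def succT (w : Index) : Index := { w with t := w.t + 1 }

/-- `(m + m', k + l', l + k'; n + n', r + t', t + r')`: the index of the product of the function
with index `w` and the complex conjugate of the function with index `w'`. -/
def pair (w w' : Index) : Index :=
  ⟨w.m + w'.m, w.k + w'.l, w.l + w'.k, w.n + w'.n, w.r + w'.t, w.t + w'.r⟩

end Index

/-- The function `x₁^m (x₁ + i)^k (x₁ - i)^l x₂^n (x₂ + i)^r (x₂ - i)^t` on `ℝ²`. -/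
noncomputable def monomial (w : Index) (p : ℝ × ℝ) : ℂ :=
  (p.1 : ℂ) ^ w.m * ((p.1 : ℂ) + Complex.I) ^ w.k * ((p.1 : ℂ) - Complex.I) ^ w.l *
    ((p.2 : ℂ) ^ w.n * ((p.2 : ℂ) + Complex.I) ^ w.r * ((p.2 : ℂ) - Complex.I) ^ w.t)

/-- The non-negative Borel measure `μ` on `ℝ²` solves the extended two-dimensional moment problem
with data `u`: all the integrals converge absolutely and have the prescribed values. -/
def IsSolution (u : Index → ℂ) (μ : Measure (ℝ × ℝ)) : Prop :=
  ∀ w : Index, Integrable (monomial w) μ ∧ ∫ p, monomial w p ∂μ = u w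

/-- The positivity condition: for every finitely supported `α`, the Hermitian sum is real and
non-negative (which is the meaning of `0 ≤ z` for complex `z`). -/
def IsPositive (u : Index → ℂ) : Prop :=
  ∀ α : Index →₀ ℂ,
    0 ≤ ∑ w ∈ α.support, ∑ w' ∈ α.support, α w * starRingEnd ℂ (α w') * u (w.pair w')

/-- The four families of linear relations. -/
structure LinearRelations (u : Index → ℂ) : Prop where
  rel_k : ∀ w w' : Index,
    u (w.succM.pair w') + Complex.I * u (w.pair w') = u (w.succK.pair w')
  rel_l : ∀ w w' : Index,
    u (w.succM.pair w') - Complex.I * u (w.pair w') = u (w.succL.pair w')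
  rel_r : ∀ w w' : Index,
    u (w.succN.pair w') + Complex.I * u (w.pair w') = u (w.succR.pair w')
  rel_t : ∀ w w' : Index,
    u (w.succN.pair w') - Complex.I * u (w.pair w') = u (w.succT.pair w')

section Hilbert

variable {H : Type*} [NormedAddCommGroup H] [InnerProductSpace ℂ H]

/-- `x` is a sequence in the Hilbert space `H`, with dense linear span, whose Gram matrix is given
by `u`: the scalar product of `x w` and `x w'`, linear in `x w`, is `u (w.pair w')`.
(Mathlib's `inner ℂ a b` is linear in `b`.) -/
structure IsModel (u : Index → ℂ) (x : Index → H) : Prop where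
  gram : ∀ w w' : Index, inner ℂ (x w') (x w) = u (w.pair w')
  dense_span : (Submodule.span ℂ (Set.range x)).topologicalClosure = ⊤

/-- The operator `∑ α_w x_w ↦ ∑ α_w x_{σ w}` on the linear span of the `x_w`, as the operator
whose graph is the span of the pairs `(x_w, x_{σ w})`. It is meaningful
when `IsWellDefinedShift x σ` holds. -/
noncomputable def shiftOperator (x : Index → H) (σ : Index → Index) : H →ₗ.[ℂ] H :=
  (Submodule.span ℂ (Set.range fun w => (x w, x (σ w)))).toLinearPMap

/-- `∑ α_w x_w ↦ ∑ α_w x_{σ w}` is correctly defined on the linear span of the `x_w`, and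
`shiftOperator x σ` is this operator. -/
def IsWellDefinedShift (x : Index → H) (σ : Index → Index) : Prop :=
  (shiftOperator x σ).domain = Submodule.span ℂ (Set.range x) ∧
  ∀ α : Index →₀ ℂ, ∃ h : (∑ w ∈ α.support, α w • x w) ∈ (shiftOperator x σ).domain,
    shiftOperator x σ ⟨∑ w ∈ α.support, α w • x w, h⟩ = ∑ w ∈ α.support, α w • x (σ w)

/-- The densely defined operator `T` is closable, and its closure is self-adjoint. -/
structure IsEssentiallySelfAdjoint [CompleteSpace H] (T : H →ₗ.[ℂ] H) : Prop where
  dense_domain : Dense (T.domain : Set H)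
  closable : T.IsClosable
  selfAdjoint : IsSelfAdjoint T.closure

/-- The bounded operator `R` is the resolvent `(T - z)⁻¹`. -/
structure IsResolventAt (T : H →ₗ.[ℂ] H) (z : ℂ) (R : H →L[ℂ] H) : Prop where
  right_inv : ∀ y : H, ∃ h : R y ∈ T.domain, T ⟨R y, h⟩ - z • R y = y
  left_inv : ∀ y : T.domain, R (T y - z • (y : H)) = y

/-- Commutation of (possibly unbounded) self-adjoint operators: the resolvents at non-real
points commute. -/
def StronglyCommute (S T : H →ₗ.[ℂ] H) : Prop :=
  ∀ z z' : ℂ, z.im ≠ 0 → z'.im ≠ 0 → ∃ R R' : H →L[ℂ] H,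
    IsResolventAt S z R ∧ IsResolventAt T z' R' ∧ R ∘L R' = R' ∘L R

end Hilbert

/-- An orthogonal spectral measure (projection-valued measure) on the measurable subsets of `X`,
with values in the orthogonal projections of the Hilbert space `H`. The values on non-measurable
sets are irrelevant. -/
structure SpectralMeasure (X : Type*) [MeasurableSpace X] (H : Type*) [NormedAddCommGroup H]
    [InnerProductSpace ℂ H] [CompleteSpace H] where
  proj : Set X → H →L[ℂ] H
  isStarProjection : ∀ s, MeasurableSet s → IsStarProjection (proj s)
  univ : proj Set.univ = 1
  inter : ∀ s t, MeasurableSet s → MeasurableSet t → proj (s ∩ t) = proj s * proj t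
  iUnion : ∀ f : ℕ → Set X, (∀ j, MeasurableSet (f j)) → Pairwise (Function.onFun Disjoint f) →
    ∀ x : H, HasSum (fun j => proj (f j) x) (proj (⋃ j, f j) x)

namespace SpectralMeasure

variable {X : Type*} [MeasurableSpace X] {H : Type*} [NormedAddCommGroup H]
  [InnerProductSpace ℂ H] [CompleteSpace H]

theorem proj_empty (E : SpectralMeasure X H) : E.proj ∅ = 0 := by
  ext x
  have h := E.iUnion (fun _ => ∅) (fun _ => MeasurableSet.empty)
    (fun i j _ => by simp [Function.onFun]) x
  have h1 := h.summable.tendsto_atTop_zero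
  simpa using tendsto_nhds_unique tendsto_const_nhds h1

theorem inner_proj (E : SpectralMeasure X H) {s : Set X} (hs : MeasurableSet s) (x : H) :
    inner ℂ x (E.proj s x) = ((‖E.proj s x‖ ^ 2 : ℝ) : ℂ) := by
  have h := E.isStarProjection s hs
  have h1 : E.proj s x = E.proj s (E.proj s x) := by
    conv_lhs => rw [← h.isIdempotentElem.eq]
    rfl
  have h2 : ContinuousLinearMap.adjoint (E.proj s) = E.proj s := h.isSelfAdjoint
  rw [h1, ← ContinuousLinearMap.adjoint_inner_left, h2, ← h1, inner_self_eq_norm_sq_to_K]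
  push_cast
  rfl

/-- The Borel measure `Δ ↦ (E(Δ) x, x)`. -/
noncomputable def scalarMeasure (E : SpectralMeasure X H) (x : H) : Measure X :=
  Measure.ofMeasurable (fun s _ => ENNReal.ofReal (inner ℂ x (E.proj s x)).re)
    (by simp [E.proj_empty])
    (by
      intro f hf hd
      have h := (E.iUnion f hf hd x).mapL (innerSL ℂ x)
      have h1 := Complex.hasSum_re h
      simp only [innerSL_apply_apply] at h1
      rw [← h1.tsum_eq, ENNReal.ofReal_tsum_of_nonneg _ h1.summable]
      intro j
      rw [E.inner_proj (hf j), Complex.ofReal_re]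
      positivity)

theorem scalarMeasure_apply (E : SpectralMeasure X H) (x : H) {s : Set X}
    (hs : MeasurableSet s) :
    E.scalarMeasure x s = ENNReal.ofReal (inner ℂ x (E.proj s x)).re :=
  Measure.ofMeasurable_apply s hs

/-- `T = ∫ f dE` for a real measurable function `f`: the domain of `T` consists of all `x` with
`∫ |f|² d(E x, x) < ∞`, and `(T x, x) = ∫ f d(E x, x)` on this domain. (By polarization `T` is
determined by these two properties, the domain being dense.) -/
def IsIntegral (E : SpectralMeasure X H) (f : X → ℝ) (T : H →ₗ.[ℂ] H) : Prop :=
  (∀ x : H, x ∈ T.domain ↔ MemLp f 2 (E.scalarMeasure x)) ∧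
  ∀ x : T.domain, inner ℂ (x : H) (T x) = ((∫ p, f p ∂(E.scalarMeasure (x : H)) : ℝ) : ℂ)

/-- `E` is a joint spectral measure of `A` and `B`: `A = ∫ x₁ dE` and `B = ∫ x₂ dE`. -/
def IsJoint (E : SpectralMeasure (ℝ × ℝ) H) (A B : H →ₗ.[ℂ] H) : Prop :=
  E.IsIntegral Prod.fst A ∧ E.IsIntegral Prod.snd B

end SpectralMeasure

end ExtMoment

open ExtMoment

/-!
The conditions are necessary because the Hermitian sum is `∫ |∑ α_w monomial w|² dμ`.

For sufficiency, Cayley transforms `z = (x - i) / (x + i)` in both variables turn the moments of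
`(x₁² + 1)^{K₁} (x₂² + 1)^{K₂} z₁^{n₁} z₂^{n₂}`, for fixed `K`, into a positive definite function of
`n ∈ ℤ²`. By Herglotz's theorem (`IsPosDef.exists_measure`, a weak limit of Fejér measures) it is
the Fourier transform of a measure `ν_K` on the torus. Since `|1 - z|² / 4 = 1 / (x² + 1)`, the
linear relations say that `ν_K` is `|1 - z_i|² / 4` times the measure with `K_i` raised by one, so
that `ν_K` does not charge `z_i = 1`. Hence all the `ν_K` come from the single measure `ν_0`
(`exists_weighted_measure`), which is transported back to the plane. All the other moments follow
by the linear relations (`LinearRelations.isSolution`). The same transport shows that the solution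
is unique and that the monomials span a dense subspace of `L²(μ)`: this is trigonometric
approximation on the torus.

A model `(H, x)` is therefore unitarily equivalent to `L²(μ)` with its monomials, as the two
families have the same Gram matrix (`exists_linearIsometryEquiv_of_gram`). There the shifts are
multiplication by the coordinates. The resolvent `(f - i)⁻¹` maps the span of the monomials to
itself, so that the closure of the shift is the full multiplication operator
(`closure_shiftGraph`), which is self-adjoint, with resolvents that commute and with the
multiplications by indicator functions as a spectral measure (`transSpectral`).

Conversely, let `E` be any joint spectral measure. For each `h`, the vectors `E(s) h` and the
indicator functions in `L²(E h, h)` have the same Gram matrix, which gives an isometry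
`φ ↦ ∫ φ dE h` (`SpectralMeasure.integralVec`). Approximation by simple functions shows that
`∫ f dE h` is linear in `h`, so that by polarization the quadratic form determines the operator
(`SpectralMeasure.IsIntegral.apply_eq`). Then `x w = ∫ monomial w dE x₀` by induction on the index,
and `(E x₀, x₀)` has the required moments (`isSolution_of_isJoint`).
-/

namespace ExtMoment

open MeasureTheory Filter
open scoped Topology ComplexOrder NNReal ENNReal

section Torus

open UnitAddTorus

variable {d : Type*} [Fintype d]

/-! ### Positive definite functions on `ℤᵈ` -/

theorem integral_mFourier_haar (n : d → ℤ) :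
    ∫ x, mFourier n x ∂(Measure.pi fun _ : d => (AddCircle.haarAddCircle : Measure UnitAddCircle))
      = if n = 0 then 1 else 0 := by
  have h1 : ∀ k : ℤ, ∫ x : UnitAddCircle, fourier k x ∂AddCircle.haarAddCircle
      = if k = 0 then (1 : ℂ) else 0 := by
    intro k
    have := congrFun (fourierCoeff_fourier (T := (1 : ℝ)) k) 0
    simp only [fourierCoeff, neg_zero, fourier_zero, one_smul] at this
    rw [this, Pi.single_apply]
    exact if_congr eq_comm rfl rfl
  simp only [mFourier, ContinuousMap.coe_mk]
  rw [integral_fintype_prod_eq_prod (𝕜 := ℂ) (E := fun _ : d => UnitAddCircle)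
    (f := fun i (x : UnitAddCircle) => (fourier (n i) x : ℂ))]
  simp only [h1]
  rw [Finset.prod_ite_zero]
  simp [funext_iff]

theorem integrable_mFourier (ν : Measure (UnitAddTorus d)) [IsFiniteMeasure ν] (n : d → ℤ) :
    Integrable (mFourier n) ν :=
  ((map_continuous (mFourier n)).integrable_of_hasCompactSupport
    (HasCompactSupport.of_compactSpace _))

/-- The function `c` on the group `ℤᵈ` is positive definite. -/
def IsPosDef (c : (d → ℤ) → ℂ) : Prop :=
  ∀ (F : Finset (d → ℤ)) (β : (d → ℤ) → ℂ),
    0 ≤ ∑ a ∈ F, ∑ b ∈ F, β a * starRingEnd ℂ (β b) * c (a - b)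

/-- The number of representations of `n` as a difference of two elements of `F`. -/
noncomputable def diffCount (F : Finset (d → ℤ)) (n : d → ℤ) : ℕ := by
  classical exact (F.filter fun b => n + b ∈ F).card

/-- The Fejér measure of a positive definite function for the finite set `F`: its density
`|F|⁻¹ ∑ c (a - b) e^{2πi(b - a)x}`, summed over `a, b ∈ F`, is non-negative by positive
definiteness. -/
theorem exists_fejer_measure {c : (d → ℤ) → ℂ} (hc : IsPosDef c) (F : Finset (d → ℤ)) :
    ∃ ν : Measure (UnitAddTorus d), IsFiniteMeasure ν ∧
      ∀ n, ∫ x, mFourier n x ∂ν = ((diffCount F n / F.card : ℝ) : ℂ) * c n := by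
  classical
  let vol : Measure (UnitAddTorus d) :=
    Measure.pi fun _ : d => (AddCircle.haarAddCircle : Measure UnitAddCircle)
  let g : C(UnitAddTorus d, ℂ) := ∑ a ∈ F, ∑ b ∈ F, c (a - b) • mFourier (b - a)
  have hg : ∀ x, g x = ∑ a ∈ F, ∑ b ∈ F, c (a - b) * mFourier (b - a) x := by
    intro x
    simp only [g, ContinuousMap.coe_sum, Finset.sum_apply, ContinuousMap.coe_smul, Pi.smul_apply,
      smul_eq_mul]
  have hg0 : ∀ x, 0 ≤ g x := by
    intro x
    have := hc F (fun a => mFourier (-a) x)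
    rw [hg]
    convert! this using 1
    refine Finset.sum_congr rfl fun a _ => Finset.sum_congr rfl fun b _ => ?_
    rw [← mFourier_neg, neg_neg, ← mFourier_add, neg_add_eq_sub, mul_comm]
  have hgr : ∀ x, ((g x).re : ℂ) = g x := fun x =>
    Complex.ext rfl (by simpa using (Complex.le_def.1 (hg0 x)).2)
  let t : ℝ := (F.card : ℝ)⁻¹
  have ht : 0 ≤ t := by positivity
  have hcont : Continuous fun x => t * (g x).re := by fun_prop
  have hint : Integrable (fun x => t * (g x).re) vol :=
    hcont.integrable_of_hasCompactSupport (HasCompactSupport.of_compactSpace _)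
  refine ⟨vol.withDensity fun x => ENNReal.ofReal (t * (g x).re),
    isFiniteMeasure_withDensity_ofReal hint.2, fun n => ?_⟩
  rw [integral_withDensity_eq_integral_toReal_smul (by fun_prop) (by simp)]
  have h1 : ∀ x, (ENNReal.ofReal (t * (g x).re)).toReal • mFourier n x
      = (t : ℂ) * ∑ a ∈ F, ∑ b ∈ F, c (a - b) * mFourier (n + b - a) x := by
    intro x
    have hre : 0 ≤ (g x).re := (Complex.le_def.1 (hg0 x)).1
    rw [ENNReal.toReal_ofReal (mul_nonneg ht hre), Complex.real_smul]
    push_cast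
    rw [hgr, hg, mul_assoc, Finset.sum_mul]
    congr 1
    refine Finset.sum_congr rfl fun a _ => ?_
    rw [Finset.sum_mul]
    refine Finset.sum_congr rfl fun b _ => ?_
    rw [mul_assoc, ← mFourier_add]
    congr 3
    abel
  have hI : ∀ k, Integrable (mFourier k) vol := integrable_mFourier vol
  simp_rw [h1]
  rw [integral_const_mul, integral_finsetSum _
    (fun a _ => integrable_finsetSum _ fun b _ => (hI _).const_mul _)]
  have h2 : ∀ a ∈ F, ∫ x, ∑ b ∈ F, c (a - b) * mFourier (n + b - a) x ∂vol
      = ∑ b ∈ F, if n + b = a then c n else 0 := by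
    intro a _
    rw [integral_finsetSum _ fun b _ => (hI _).const_mul _]
    refine Finset.sum_congr rfl fun b _ => ?_
    rw [integral_const_mul, integral_mFourier_haar]
    by_cases h : n + b = a
    · subst h
      simp
    · rw [if_neg h, if_neg (fun h' => h (sub_eq_zero.1 h')), mul_zero]
  rw [Finset.sum_congr rfl h2, Finset.sum_comm]
  simp only [Finset.sum_ite_eq, ← Finset.sum_filter, Finset.sum_const, nsmul_eq_mul, diffCount, t]
  push_cast
  ring

theorem diffCount_le (F : Finset (d → ℤ)) (n : d → ℤ) : diffCount F n ≤ F.card := by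
  classical exact Finset.card_filter_le _ _

/-- The cubes `[0, N]ᵈ` form a Følner sequence. -/
theorem tendsto_diffCount_box [DecidableEq d] (n : d → ℤ) :
    Tendsto (fun N : ℕ => (diffCount (Fintype.piFinset fun _ : d => Finset.Ico (0 : ℤ) (N + 1)) n /
      (Fintype.piFinset fun _ : d => Finset.Ico (0 : ℤ) (N + 1)).card : ℝ)) atTop (𝓝 1) := by
  classical
  have key : ∀ N : ℕ,
      (diffCount (Fintype.piFinset fun _ : d => Finset.Ico (0 : ℤ) (N + 1)) n /
        (Fintype.piFinset fun _ : d => Finset.Ico (0 : ℤ) (N + 1)).card : ℝ)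
      = ∏ i, ((((Finset.Ico (0 : ℤ) (N + 1)).filter
          fun b => n i + b ∈ Finset.Ico (0 : ℤ) (N + 1)).card : ℝ) / (N + 1)) := by
    intro N
    have h1 : (Fintype.piFinset fun _ : d => Finset.Ico (0 : ℤ) (N + 1)).filter
        (fun b => n + b ∈ Fintype.piFinset fun _ : d => Finset.Ico (0 : ℤ) (N + 1))
        = Fintype.piFinset fun i => (Finset.Ico (0 : ℤ) (N + 1)).filter
          fun b => n i + b ∈ Finset.Ico (0 : ℤ) (N + 1) := by
      ext b
      simp only [Finset.mem_filter, Fintype.mem_piFinset, Pi.add_apply, forall_and]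
    simp only [diffCount]
    rw [h1, Fintype.card_piFinset, Fintype.card_piFinset, Finset.prod_div_distrib]
    push_cast
    congr 1
    refine Finset.prod_congr rfl fun i _ => ?_
    rw [Int.card_Ico]
    simp
  simp_rw [key]
  suffices h : ∀ i, Tendsto (fun N : ℕ => ((((Finset.Ico (0 : ℤ) (N + 1)).filter
      fun b => n i + b ∈ Finset.Ico (0 : ℤ) (N + 1)).card : ℝ) / (N + 1))) atTop (𝓝 1) by
    simpa using tendsto_finsetProd Finset.univ fun i _ => h i
  intro i
  have hlow : Tendsto (fun N : ℕ => 1 - (|n i| : ℝ) * (1 / ((N : ℝ) + 1))) atTop (𝓝 1) := by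
    have := tendsto_one_div_add_atTop_nhds_zero_nat (𝕜 := ℝ)
    simpa using (this.const_mul (|n i| : ℝ)).const_sub 1
  refine tendsto_of_tendsto_of_tendsto_of_le_of_le hlow tendsto_const_nhds (fun N => ?_)
    (fun N => ?_)
  · have hsub' : Finset.Ico (max 0 (-n i)) (min (N + 1) (N + 1 - n i)) ⊆
        (Finset.Ico (0 : ℤ) (N + 1)).filter fun b => n i + b ∈ Finset.Ico (0 : ℤ) (N + 1) := by
      intro b
      simp only [Finset.mem_Ico, Finset.mem_filter]
      omega
    have hcard := Finset.card_le_card hsub'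
    rw [Int.card_Ico] at hcard
    have hz : ((N : ℤ) + 1 - |n i|) ≤ (((Finset.Ico (0 : ℤ) (N + 1)).filter
          fun b => n i + b ∈ Finset.Ico (0 : ℤ) (N + 1)).card : ℤ) := by
      rcases abs_cases (n i) with h | h <;> omega
    have hz' : ((N : ℝ) + 1 - |(n i : ℝ)|) ≤ (((Finset.Ico (0 : ℤ) (N + 1)).filter
          fun b => n i + b ∈ Finset.Ico (0 : ℤ) (N + 1)).card : ℝ) := by exact_mod_cast hz
    have hN : (0 : ℝ) < (N : ℝ) + 1 := by positivity
    rw [le_div_iff₀ hN]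
    field_simp
    exact hz'
  · have h := Finset.card_filter_le (Finset.Ico (0 : ℤ) (N + 1))
      fun b => n i + b ∈ Finset.Ico (0 : ℤ) (N + 1)
    rw [Int.card_Ico] at h
    have hN : (0 : ℝ) < (N : ℝ) + 1 := by positivity
    simp only
    rw [div_le_one hN]
    have h' : (((Finset.Ico (0 : ℤ) (N + 1)).filter
          fun b => n i + b ∈ Finset.Ico (0 : ℤ) (N + 1)).card : ℤ) ≤ N + 1 := by omega
    exact_mod_cast h'

/-- **Herglotz's theorem** on `ℤᵈ`: a positive definite function is the Fourier transform of a
finite measure on the torus. The measure is a weak limit of Fejér measures. -/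
theorem IsPosDef.exists_measure {c : (d → ℤ) → ℂ} (hc : IsPosDef c) :
    ∃ ν : Measure (UnitAddTorus d), IsFiniteMeasure ν ∧ ∀ n, ∫ x, mFourier n x ∂ν = c n := by
  classical
  let F : ℕ → Finset (d → ℤ) := fun N => Fintype.piFinset fun _ : d => Finset.Ico (0 : ℤ) (N + 1)
  choose ν hfin hν using fun N => exists_fejer_measure hc (F N)
  let μ : ℕ → FiniteMeasure (UnitAddTorus d) := fun N => ⟨ν N, hfin N⟩
  have hmass : ∀ N, (μ N).mass ≤ ‖c 0‖₊ := by
    intro N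
    have h0 := hν N 0
    rw [mFourier_zero] at h0
    simp only [ContinuousMap.one_apply, integral_const] at h0
    have h1 : (ν N).real Set.univ ≤ ‖c 0‖ := by
      have hle : ((diffCount (F N) 0 : ℝ) / (F N).card) ≤ 1 :=
        div_le_one_of_le₀ (by exact_mod_cast diffCount_le _ _) (by positivity)
      have h3 := congrArg norm h0
      rw [norm_smul, norm_one, mul_one, Real.norm_of_nonneg measureReal_nonneg, norm_mul,
        Complex.norm_real, Real.norm_of_nonneg (by positivity)] at h3
      rw [h3]
      exact mul_le_of_le_one_left (norm_nonneg _) hle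
    exact h1
  have hcomp : IsCompact {m : FiniteMeasure (UnitAddTorus d) | m.mass ≤ ‖c 0‖₊} := by
    simpa using isCompact_setOfPred_finiteMeasure_le_of_compactSpace (UnitAddTorus d) ‖c 0‖₊
  let l : Ultrafilter ℕ := Filter.hyperfilter ℕ
  have hl : (l : Filter ℕ) ≤ atTop := by
    simpa [Nat.cofinite_eq_atTop] using Filter.hyperfilter_le_cofinite (α := ℕ)
  obtain ⟨m, -, hm⟩ := hcomp.ultrafilter_le_nhds (l.map μ)
    (by rw [le_principal_iff, Ultrafilter.coe_map, mem_map];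
        exact Filter.Eventually.of_forall hmass)
  have hm' : Tendsto μ l (𝓝 m) := hm
  rw [FiniteMeasure.tendsto_iff_forall_integral_rclike_tendsto ℂ] at hm'
  refine ⟨m, inferInstance, fun n => ?_⟩
  have h1 := hm' (BoundedContinuousFunction.mkOfCompact (mFourier n))
  have h2 : Tendsto (fun N => ((diffCount (F N) n / (F N).card : ℝ) : ℂ) * c n) l (𝓝 (c n)) := by
    have := ((Complex.continuous_ofReal.tendsto _).comp
      ((tendsto_diffCount_box n).mono_left hl)).mul_const (c n)
    rw [Complex.ofReal_one, one_mul] at this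
    exact this
  exact tendsto_nhds_unique (h1.congr fun N => hν N n) h2

/-- A finite measure on the torus is determined by its Fourier coefficients. -/
theorem measure_ext_of_integral_mFourier {ν ν' : Measure (UnitAddTorus d)} [IsFiniteMeasure ν]
    [IsFiniteMeasure ν'] (h : ∀ n, ∫ x, mFourier n x ∂ν = ∫ x, mFourier n x ∂ν') : ν = ν' := by
  let A : StarSubalgebra ℂ (BoundedContinuousFunction (UnitAddTorus d) ℂ) :=
    (mFourierSubalgebra d).comap (BoundedContinuousFunction.toContinuousMapStarₐ ℂ)
  have hI : ∀ (ρ : Measure (UnitAddTorus d)) [IsFiniteMeasure ρ] (f : C(UnitAddTorus d, ℂ)),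
      Integrable f ρ := fun ρ _ f => (map_continuous f).integrable_of_hasCompactSupport
        (HasCompactSupport.of_compactSpace _)
  have key : ∀ f ∈ mFourierSubalgebra d, ∫ x, f x ∂ν = ∫ x, f x ∂ν' := by
    intro f hf
    have hf' : f ∈ Submodule.span ℂ (Set.range (mFourier (d := d))) := by
      rw [← mFourierSubalgebra_coe]
      exact hf
    clear hf
    induction hf' using Submodule.span_induction with
    | mem f hf =>
      obtain ⟨n, rfl⟩ := hf
      exact h n
    | zero => simp
    | add f g _ _ hf hg =>
      simp only [ContinuousMap.add_apply]
      rw [integral_add (hI ν f) (hI ν g), integral_add (hI ν' f) (hI ν' g)]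
      rw [hf, hg]
    | smul a f _ hf =>
      simp only [ContinuousMap.smul_apply]
      rw [integral_smul, integral_smul, hf]
  refine ext_of_forall_mem_subalgebra_integral_eq_of_polish (𝕜 := ℂ) (A := A) ?_ ?_
  · intro x y hxy
    obtain ⟨_, ⟨f, hf, rfl⟩, hfxy⟩ := mFourierSubalgebra_separatesPoints (d := d) hxy
    refine ⟨f, ⟨f, ⟨BoundedContinuousFunction.mkOfCompact f, ?_, ?_⟩, rfl⟩, hfxy⟩
    · exact hf
    · ext x
      rfl
  · intro g hg
    exact key _ hg

end Torus

section Weight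

open UnitAddTorus

/-! ### The weight of the Cayley transform on the torus -/

/-- The function `|1 - z|² / 4 = (1 - Re z) / 2` of `z = e^{2πiθ}`. -/
noncomputable def weight (θ : UnitAddCircle) : ℝ := (1 - (fourier 1 θ : ℂ).re) / 2

theorem continuous_weight : Continuous weight := by
  unfold weight
  fun_prop

theorem fourier_mul_conj (θ : UnitAddCircle) :
    (fourier 1 θ : ℂ) * starRingEnd ℂ (fourier 1 θ) = 1 := by
  rw [← fourier_neg, ← fourier_add]
  simp

theorem fourier_one_ne_zero (θ : UnitAddCircle) : (fourier 1 θ : ℂ) ≠ 0 := fun h => by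
  simpa [h] using fourier_mul_conj θ

theorem coe_weight (θ : UnitAddCircle) :
    (weight θ : ℂ) = (2 - fourier 1 θ - starRingEnd ℂ (fourier 1 θ)) / 4 := by
  have h := Complex.add_conj (fourier 1 θ : ℂ)
  rw [sub_sub, h, weight]
  push_cast
  ring

theorem weight_nonneg (θ : UnitAddCircle) : 0 ≤ weight θ := by
  have h := Complex.re_le_norm (fourier 1 θ : ℂ)
  have h1 : ‖(fourier 1 θ : ℂ)‖ = 1 := by
    rw [fourier_apply, Circle.norm_coe]
  rw [weight]
  linarith

theorem coe_weight_eq (θ : UnitAddCircle) :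
    (weight θ : ℂ) = -(1 - fourier 1 θ) ^ 2 / (4 * fourier 1 θ) := by
  have h0 := fourier_one_ne_zero θ
  have h1 := fourier_mul_conj θ
  rw [coe_weight, eq_inv_of_mul_eq_one_right h1]
  field_simp
  ring

theorem weight_eq_zero_iff (θ : UnitAddCircle) : weight θ = 0 ↔ (fourier 1 θ : ℂ) = 1 := by
  rw [← Complex.ofReal_eq_zero, coe_weight_eq, div_eq_zero_iff]
  simp only [neg_eq_zero, ne_eq, OfNat.ofNat_ne_zero, not_false_eq_true, pow_eq_zero_iff,
    mul_eq_zero, fourier_one_ne_zero θ, or_self, or_false, sub_eq_zero]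
  exact eq_comm

variable {d : Type*} [Fintype d] [DecidableEq d]

theorem coe_weight_mul_mFourier (x : UnitAddTorus d) (i : d) (n : d → ℤ) :
    (weight (x i) : ℂ) * mFourier n x =
      (2 * mFourier n x - mFourier (n + Pi.single i 1) x - mFourier (n - Pi.single i 1) x) / 4 := by
  rw [coe_weight, sub_eq_add_neg n, mFourier_add, mFourier_add, mFourier_neg, mFourier_single]
  ring

/-- A family `c` of positive definite functions which is consistent with multiplication by the
weights comes from a single measure. The measure has no mass on the hyperplanes where a weight
vanishes, so that negative powers of the weights make sense almost everywhere. -/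
theorem exists_weighted_measure {c : (d → ℤ) → (d → ℤ) → ℂ} (hc : ∀ K, IsPosDef (c K))
    (hrel : ∀ K i n, 4 * c K n = 2 * c (K + Pi.single i 1) n -
      c (K + Pi.single i 1) (n + Pi.single i 1) - c (K + Pi.single i 1) (n - Pi.single i 1)) :
    ∃ ν : Measure (UnitAddTorus d), IsFiniteMeasure ν ∧ (∀ i, ∀ᵐ x ∂ν, (fourier 1 (x i) : ℂ) ≠ 1) ∧
      ∀ K n, Integrable (fun x => ((∏ i, weight (x i) ^ (-K i) : ℝ) : ℂ) * mFourier n x) ν ∧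
        ∫ x, ((∏ i, weight (x i) ^ (-K i) : ℝ) : ℂ) * mFourier n x ∂ν = c K n := by
  choose ν hfin hν using fun K => (hc K).exists_measure
  have hwm : ∀ i, Measurable fun x : UnitAddTorus d => weight (x i) := fun i =>
    continuous_weight.measurable.comp (measurable_pi_apply i)
  have hwi : ∀ i, Continuous fun x : UnitAddTorus d => weight (x i) := fun i =>
    continuous_weight.comp (continuous_apply i)
  have hI : ∀ K i, Integrable (fun x : UnitAddTorus d => weight (x i)) (ν K) := fun K i =>
    (hwi i).integrable_of_hasCompactSupport (HasCompactSupport.of_compactSpace _)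
  have hstep : ∀ K i, ν K = (ν (K + Pi.single i 1)).withDensity
      fun x => ENNReal.ofReal (weight (x i)) := by
    intro K i
    have := isFiniteMeasure_withDensity_ofReal (hI (K + Pi.single i 1) i).2
    refine measure_ext_of_integral_mFourier fun n => ?_
    rw [integral_withDensity_eq_integral_toReal_smul (by fun_prop) (by simp), hν]
    have h1 : ∀ x : UnitAddTorus d, (ENNReal.ofReal (weight (x i))).toReal • mFourier n x =
        (2 * mFourier n x - mFourier (n + Pi.single i 1) x -
          mFourier (n - Pi.single i 1) x) / 4 := by
      intro x
      rw [ENNReal.toReal_ofReal (weight_nonneg _), Complex.real_smul, coe_weight_mul_mFourier]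
    have hm := integrable_mFourier (ν (K + Pi.single i 1))
    have hA : Integrable (fun x => 2 * mFourier n x - mFourier (n + Pi.single i 1) x)
        (ν (K + Pi.single i 1)) := ((hm _).const_mul _).sub (hm _)
    simp_rw [h1]
    rw [integral_div, integral_sub hA (hm _),
      integral_sub ((hm _).const_mul _) (hm _), integral_const_mul, hν, hν, hν, ← hrel]
    ring
  have hne : ∀ K i, ∀ᵐ x ∂(ν K), weight (x i) ≠ 0 := by
    intro K i
    rw [hstep K i, ae_withDensity_iff (by fun_prop)]
    refine Eventually.of_forall fun x hx h0 => hx ?_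
    simp [h0]
  -- `S K` says that the measure with index `K` comes from the one with index `0`. Its truth does not
  -- change when `K` moves by a standard basis vector, and these generate `ℤᵈ`.
  let S : (d → ℤ) → Prop := fun K =>
    ν K = (ν 0).withDensity fun x => ENNReal.ofReal (∏ i, weight (x i) ^ (-K i))
  have hprod : ∀ (K : d → ℤ) i (x : UnitAddTorus d), weight (x i) ≠ 0 →
      (∏ j, weight (x j) ^ (-((K + Pi.single i 1 : d → ℤ) j))) =
        (∏ j, weight (x j) ^ (-K j)) * (weight (x i))⁻¹ := by
    intro K i x hx
    rw [← Finset.mul_prod_erase _ _ (Finset.mem_univ i),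
      ← Finset.mul_prod_erase (a := i) (f := fun j => weight (x j) ^ (-K j)) _ (Finset.mem_univ i),
      Finset.prod_congr rfl (g := fun j => weight (x j) ^ (-K j))]
    · rw [Pi.add_apply, Pi.single_eq_same, neg_add, zpow_add₀ hx, zpow_neg_one]
      ring
    · intro j hj
      rw [Pi.add_apply, Pi.single_eq_of_ne (Finset.ne_of_mem_erase hj), add_zero]
  have hpm : ∀ K : d → ℤ, Measurable fun x : UnitAddTorus d => ∏ j, weight (x j) ^ (-K j) :=
    fun K => Finset.measurable_prod _ fun j _ => (hwm j).pow_const _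
  have hp0 : ∀ (K : d → ℤ) (x : UnitAddTorus d), 0 ≤ ∏ j, weight (x j) ^ (-K j) := fun K x =>
    Finset.prod_nonneg fun j _ => zpow_nonneg (weight_nonneg _) _
  have hS : ∀ K i, S K ↔ S (K + Pi.single i 1) := by
    intro K i
    constructor
    · intro h
      have h1 : ν (K + Pi.single i 1) =
          (ν K).withDensity fun x => ENNReal.ofReal ((weight (x i))⁻¹) := by
        rw [hstep K i, ← withDensity_mul _ (by fun_prop) (by fun_prop)]
        conv_lhs => rw [← withDensity_one (μ := ν (K + Pi.single i 1))]
        refine withDensity_congr_ae ?_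
        filter_upwards [hne (K + Pi.single i 1) i] with x hx
        rw [Pi.mul_apply, ← ENNReal.ofReal_mul (weight_nonneg _), mul_inv_cancel₀ hx]
        simp
      change ν _ = _
      rw [h1, h, ← withDensity_mul _ (hpm K).ennreal_ofReal (by fun_prop)]
      refine withDensity_congr_ae ?_
      filter_upwards [hne 0 i] with x hx
      rw [Pi.mul_apply, ← ENNReal.ofReal_mul (hp0 K x), hprod K i x hx]
    · intro h
      change ν _ = _
      rw [hstep K i, h, ← withDensity_mul _ (hpm _).ennreal_ofReal (by fun_prop)]
      refine withDensity_congr_ae ?_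
      filter_upwards [hne 0 i] with x hx
      rw [Pi.mul_apply, ← ENNReal.ofReal_mul (hp0 _ x), hprod K i x hx, inv_mul_cancel_right₀ hx]
  let G : AddSubgroup (d → ℤ) :=
    { carrier := {v | ∀ K, S K ↔ S (K + v)}
      zero_mem' := fun K => by rw [add_zero]
      add_mem' := fun {v w} hv hw K => by rw [← add_assoc, ← hw, ← hv]
      neg_mem' := fun {v} hv K => by rw [hv (K + -v), neg_add_cancel_right] }
  have hG : ∀ K, S K := by
    intro K
    have hK : K ∈ G := by
      have : K = ∑ i, K i • Pi.single i (1 : ℤ) := by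
        ext j
        simp [Finset.sum_apply, Pi.single_apply]
      rw [this]
      exact sum_mem fun i _ => zsmul_mem (show Pi.single i 1 ∈ G from fun K => hS K i) _
    have h0 : S 0 := by
      change ν 0 = _
      simp
    simpa using (hK 0).1 h0
  refine ⟨ν 0, hfin 0, fun i => ?_, fun K n => ?_⟩
  · filter_upwards [hne 0 i] with x hx
    rwa [Ne, ← weight_eq_zero_iff]
  · have h1 := hν K n
    have h2 := integrable_mFourier (ν K) n
    have h3 : ∀ x : UnitAddTorus d, (ENNReal.ofReal (∏ i, weight (x i) ^ (-K i))).toReal •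
        mFourier n x = ((∏ i, weight (x i) ^ (-K i) : ℝ) : ℂ) * mFourier n x := by
      intro x
      rw [ENNReal.toReal_ofReal (hp0 K x), Complex.real_smul]
    have h4 := hG K
    simp only [S] at h4
    rw [h4, integral_withDensity_eq_integral_toReal_smul (hpm K).ennreal_ofReal (by simp)] at h1
    rw [h4, integrable_withDensity_iff_integrable_smul' (hpm K).ennreal_ofReal (by simp)] at h2
    simp_rw [h3] at h1 h2
    exact ⟨h2, h1⟩

end Weight

section Cayley

open UnitAddTorus

/-! ### The monomials -/

theorem coe_add_I_ne_zero (x : ℝ) : (x : ℂ) + Complex.I ≠ 0 := fun h => by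
  simpa using congrArg Complex.im h

theorem coe_sub_I_ne_zero (x : ℝ) : (x : ℂ) - Complex.I ≠ 0 := fun h => by
  simpa using congrArg Complex.im h

theorem monomial_zero (p : ℝ × ℝ) : monomial Index.zero p = 1 := by
  simp [monomial, Index.zero]

theorem monomial_succM (w : Index) (p : ℝ × ℝ) : monomial w.succM p = p.1 * monomial w p := by
  simp only [monomial, Index.succM, pow_succ]
  ring

theorem monomial_succN (w : Index) (p : ℝ × ℝ) : monomial w.succN p = p.2 * monomial w p := by
  simp only [monomial, Index.succN, pow_succ]
  ring

theorem monomial_succK (w : Index) (p : ℝ × ℝ) :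
    monomial w.succK p = (p.1 + Complex.I) * monomial w p := by
  simp only [monomial, Index.succK, zpow_add_one₀ (coe_add_I_ne_zero _)]
  ring

theorem monomial_succL (w : Index) (p : ℝ × ℝ) :
    monomial w.succL p = (p.1 - Complex.I) * monomial w p := by
  simp only [monomial, Index.succL, zpow_add_one₀ (coe_sub_I_ne_zero _)]
  ring

theorem monomial_succR (w : Index) (p : ℝ × ℝ) :
    monomial w.succR p = (p.2 + Complex.I) * monomial w p := by
  simp only [monomial, Index.succR, zpow_add_one₀ (coe_add_I_ne_zero _)]
  ring

theorem monomial_succT (w : Index) (p : ℝ × ℝ) :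
    monomial w.succT p = (p.2 - Complex.I) * monomial w p := by
  simp only [monomial, Index.succT, zpow_add_one₀ (coe_sub_I_ne_zero _)]
  ring

theorem monomial_pair (w w' : Index) (p : ℝ × ℝ) :
    monomial (w.pair w') p = monomial w p * starRingEnd ℂ (monomial w' p) := by
  simp only [monomial, Index.pair, map_mul, map_pow, map_zpow₀, map_add, map_sub, Complex.conj_I,
    Complex.conj_ofReal, pow_add, zpow_add₀ (coe_add_I_ne_zero _), zpow_add₀ (coe_sub_I_ne_zero _),
    sub_neg_eq_add, ← sub_eq_add_neg]
  ring

theorem measurable_monomial (w : Index) : Measurable (monomial w) := by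
  unfold monomial
  fun_prop

theorem Index.pair_zero (w : Index) : w.pair Index.zero = w := by
  ext <;> simp [Index.pair, Index.zero]

/-! ### Cayley transform between the line and the circle -/

/-- The inverse Cayley transform `θ ↦ i (1 + z) / (1 - z)` of `z = e^{2πiθ}`. At `z = 1` the value
is the junk value `0`. -/
noncomputable def toLine (θ : UnitAddCircle) : ℝ :=
  (Complex.I * (1 + fourier 1 θ) / (1 - fourier 1 θ)).re

/-- The angle `θ` with `e^{2πiθ} = (x - i) / (x + i)`. -/
noncomputable def toAngle (x : ℝ) : UnitAddCircle :=
  (AddCircle.homeomorphCircle one_ne_zero).symm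
    (Circle.ofConjDivSelf ((x : ℂ) + Complex.I) (coe_add_I_ne_zero x))

theorem fourier_toAngle (x : ℝ) :
    (fourier 1 (toAngle x) : ℂ) = ((x : ℂ) - Complex.I) / ((x : ℂ) + Complex.I) := by
  have h : AddCircle.toCircle (toAngle x) =
      Circle.ofConjDivSelf ((x : ℂ) + Complex.I) (coe_add_I_ne_zero x) := by
    rw [← AddCircle.homeomorphCircle_apply one_ne_zero, toAngle, Homeomorph.apply_symm_apply]
  rw [fourier_one, h]
  simp [Circle.ofConjDivSelf, ← sub_eq_add_neg]

theorem measurable_toLine : Measurable toLine := by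
  unfold toLine
  have : Measurable fun θ : UnitAddCircle => (fourier 1 θ : ℂ) := (map_continuous _).measurable
  fun_prop

theorem measurable_toAngle : Measurable toAngle := by
  unfold toAngle
  refine ((AddCircle.homeomorphCircle one_ne_zero).symm.continuous.comp ?_).measurable
  refine Continuous.subtype_mk ?_ _
  change Continuous fun x : ℝ => starRingEnd ℂ ((x : ℂ) + Complex.I) / ((x : ℂ) + Complex.I)
  exact Continuous.div (by fun_prop) (by fun_prop) coe_add_I_ne_zero

theorem coe_toLine (θ : UnitAddCircle) :
    (toLine θ : ℂ) = Complex.I * (1 + fourier 1 θ) / (1 - fourier 1 θ) := by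
  have h0 := fourier_one_ne_zero θ
  have h1 := fourier_mul_conj θ
  refine Complex.conj_eq_iff_re.1 ?_
  rw [map_div₀, map_mul, map_add, map_sub, map_one, Complex.conj_I,
    eq_inv_of_mul_eq_one_right h1]
  by_cases h : (fourier 1 θ : ℂ) = 1
  · simp [h]
  · have h2 : (1 - fourier 1 θ : ℂ) ≠ 0 := sub_ne_zero.2 (Ne.symm h)
    have h3 : (1 - (fourier 1 θ : ℂ)⁻¹) ≠ 0 := by
      rw [Ne, sub_eq_zero, eq_comm, inv_eq_one]
      exact h
    rw [div_eq_div_iff h3 h2]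
    field_simp
    ring

theorem toLine_toAngle (x : ℝ) : toLine (toAngle x) = x := by
  have h := coe_add_I_ne_zero x
  rw [← Complex.ofReal_inj, coe_toLine, fourier_toAngle]
  have h1 : (1 + (x - Complex.I) / (x + Complex.I) : ℂ) = 2 * x / (x + Complex.I) := by
    field_simp
    ring
  have h2 : (1 - (x - Complex.I) / (x + Complex.I) : ℂ) = 2 * Complex.I / (x + Complex.I) := by
    field_simp
    ring
  rw [h1, h2]
  field_simp [Complex.I_ne_zero]

theorem toLine_zpow (θ : UnitAddCircle) (h : (fourier 1 θ : ℂ) ≠ 1) (K n : ℤ) :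
    (toLine θ + Complex.I : ℂ) ^ (K - n) * (toLine θ - Complex.I : ℂ) ^ (K + n) =
      (weight θ : ℂ) ^ (-K) * fourier n θ := by
  have h0 := fourier_one_ne_zero θ
  have h2 : (1 - fourier 1 θ : ℂ) ≠ 0 := sub_ne_zero.2 (Ne.symm h)
  have ha : (toLine θ + Complex.I : ℂ) = 2 * Complex.I / (1 - fourier 1 θ) := by
    rw [coe_toLine]
    field_simp
    ring
  have hb : (toLine θ - Complex.I : ℂ) = (toLine θ + Complex.I : ℂ) * fourier 1 θ := by
    rw [ha, coe_toLine]
    field_simp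
    ring
  have hc : (toLine θ + Complex.I : ℂ) * (toLine θ - Complex.I : ℂ) = (weight θ : ℂ)⁻¹ := by
    rw [hb, ha, coe_weight_eq]
    field_simp
    rw [Complex.I_sq]
    ring
  have hn : (fourier n θ : ℂ) = (fourier 1 θ : ℂ) ^ n := by
    rw [fourier_apply, AddCircle.toCircle_zsmul, fourier_one, Circle.coe_zpow]
  have hd := coe_add_I_ne_zero (toLine θ)
  rw [zpow_neg, ← inv_zpow, ← hc, hn, hb, mul_zpow, mul_zpow, mul_zpow, zpow_sub₀ hd,
    zpow_add₀ hd, zpow_add₀ h0]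
  field_simp

/-- The inverse Cayley transform in both variables. -/
noncomputable def toPlane (x : UnitAddTorus (Fin 2)) : ℝ × ℝ := (toLine (x 0), toLine (x 1))

/-- The Cayley transform in both variables. -/
noncomputable def toTorus (p : ℝ × ℝ) : UnitAddTorus (Fin 2) := ![toAngle p.1, toAngle p.2]

theorem measurable_toPlane : Measurable toPlane :=
  (measurable_toLine.comp (measurable_pi_apply 0)).prodMk
    (measurable_toLine.comp (measurable_pi_apply 1))

theorem measurable_toTorus : Measurable toTorus := by
  rw [measurable_pi_iff]
  intro i
  fin_cases i
  · exact measurable_toAngle.comp measurable_fst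
  · exact measurable_toAngle.comp measurable_snd

theorem toPlane_toTorus (p : ℝ × ℝ) : toPlane (toTorus p) = p := by
  simp [toPlane, toTorus, toLine_toAngle]

/-- The index of `(x₁² + 1)^{K₁} z₁^{n₁} (x₂² + 1)^{K₂} z₂^{n₂}`, where `z` is the Cayley
transform of `x`. -/
def torusIndex (K n : Fin 2 → ℤ) : Index :=
  ⟨0, K 0 - n 0, K 0 + n 0, 0, K 1 - n 1, K 1 + n 1⟩

theorem monomial_torusIndex (K n : Fin 2 → ℤ) (x : UnitAddTorus (Fin 2))
    (h : ∀ i, (fourier 1 (x i) : ℂ) ≠ 1) :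
    monomial (torusIndex K n) (toPlane x) =
      ((∏ i, weight (x i) ^ (-K i) : ℝ) : ℂ) * mFourier n x := by
  simp only [monomial, torusIndex, toPlane, pow_zero, one_mul, toLine_zpow _ (h _), mFourier,
    ContinuousMap.coe_mk, Fin.prod_univ_two]
  push_cast
  ring

theorem monomial_torusIndex_zero (n : Fin 2 → ℤ) (p : ℝ × ℝ) :
    monomial (torusIndex 0 n) p = mFourier n (toTorus p) := by
  have h1 : ∀ i, (fourier 1 (toTorus p i) : ℂ) ≠ 1 := by
    have : ∀ x : ℝ, (fourier 1 (toAngle x) : ℂ) ≠ 1 := by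
      intro x
      rw [fourier_toAngle, Ne, div_eq_one_iff_eq (coe_add_I_ne_zero x), sub_eq_iff_eq_add,
        add_assoc, left_eq_add]
      simp [← two_mul, Complex.I_ne_zero]
    intro i
    fin_cases i
    · exact this _
    · exact this _
  conv_lhs => rw [← toPlane_toTorus p]
  rw [monomial_torusIndex 0 n _ h1]
  simp

end Cayley

section Moments

open UnitAddTorus

variable {u : Index → ℂ} {μ μ' : Measure (ℝ × ℝ)}

/-! ### Necessity of the conditions -/

theorem IsSolution.isFiniteMeasure (h : IsSolution u μ) : IsFiniteMeasure μ := by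
  have h1 := (h Index.zero).1
  rw [show monomial Index.zero = fun _ => (1 : ℂ) from funext monomial_zero,
    integrable_const_iff] at h1
  exact h1.resolve_left one_ne_zero

theorem IsSolution.isPositive (h : IsSolution u μ) : IsPositive u := by
  intro α
  have h1 : ∑ w ∈ α.support, ∑ w' ∈ α.support, α w * starRingEnd ℂ (α w') * u (w.pair w') =
      ∫ p, ((Complex.normSq (∑ w ∈ α.support, α w * monomial w p) : ℝ) : ℂ) ∂μ := by
    have h2 : ∀ p, ((Complex.normSq (∑ w ∈ α.support, α w * monomial w p) : ℝ) : ℂ) =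
        ∑ w ∈ α.support, ∑ w' ∈ α.support,
          α w * starRingEnd ℂ (α w') * monomial (w.pair w') p := by
      intro p
      rw [← Complex.mul_conj, map_sum, Finset.sum_mul_sum]
      refine Finset.sum_congr rfl fun w _ => Finset.sum_congr rfl fun w' _ => ?_
      rw [map_mul, monomial_pair]
      ring
    simp_rw [h2]
    rw [integral_finsetSum _ fun w _ => integrable_finsetSum _ fun w' _ => (h _).1.const_mul _]
    refine Finset.sum_congr rfl fun w _ => ?_
    rw [integral_finsetSum _ fun w' _ => (h _).1.const_mul _]
    refine Finset.sum_congr rfl fun w' _ => ?_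
    rw [integral_const_mul, (h _).2]
  rw [h1, integral_complex_ofReal]
  exact Complex.zero_le_real.2 (integral_nonneg fun p => Complex.normSq_nonneg _)

theorem IsSolution.linearRelations (h : IsSolution u μ) : LinearRelations u := by
  have hc : ∀ w (c : ℂ), Integrable (fun p => c * monomial w p) μ := fun w c => (h w).1.const_mul c
  constructor <;> intro w w' <;> simp only [← (h _).2, ← integral_const_mul]
  · rw [← integral_add (h _).1 (hc _ _)]
    simp only [monomial_pair, monomial_succM, monomial_succK]
    exact integral_congr_ae (Eventually.of_forall fun p => by ring)
  · rw [← integral_sub (h _).1 (hc _ _)]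
    simp only [monomial_pair, monomial_succM, monomial_succL]
    exact integral_congr_ae (Eventually.of_forall fun p => by ring)
  · rw [← integral_add (h _).1 (hc _ _)]
    simp only [monomial_pair, monomial_succN, monomial_succR]
    exact integral_congr_ae (Eventually.of_forall fun p => by ring)
  · rw [← integral_sub (h _).1 (hc _ _)]
    simp only [monomial_pair, monomial_succN, monomial_succT]
    exact integral_congr_ae (Eventually.of_forall fun p => by ring)

/-! ### Existence of a solution -/

theorem IsPositive.sum_nonneg (h : IsPositive u) {ι : Type*} (F : Finset ι) (ω : ι → Index)
    (β : ι → ℂ) :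
    0 ≤ ∑ a ∈ F, ∑ b ∈ F, β a * starRingEnd ℂ (β b) * u ((ω a).pair (ω b)) := by
  have h1 := h (∑ a ∈ F, Finsupp.single (ω a) (β a))
  set α := ∑ a ∈ F, Finsupp.single (ω a) (β a) with hα
  have h2 : α.sum (fun w z => α.sum fun w' z' => z * starRingEnd ℂ z' * u (w.pair w')) =
      ∑ a ∈ F, ∑ b ∈ F, β a * starRingEnd ℂ (β b) * u ((ω a).pair (ω b)) := by
    conv_lhs => rw [hα]
    rw [← Finsupp.sum_finsetSum_index (by simp) (by simp [add_mul, Finsupp.sum_add])]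
    refine Finset.sum_congr rfl fun a _ => ?_
    rw [Finsupp.sum_single_index (by simp),
      ← Finsupp.sum_finsetSum_index (by simp) (by simp [add_mul, mul_add])]
    refine Finset.sum_congr rfl fun b _ => ?_
    rw [Finsupp.sum_single_index (by simp)]
  rw [← h2]
  exact h1

theorem IsPositive.isPosDef (h : IsPositive u) (K : Fin 2 → ℤ) :
    IsPosDef fun n => u (torusIndex K n) := by
  intro F β
  -- The function `(x + i)^{K - n} (x - i)^n` times the conjugate of the one with `n'` is
  -- `(x + i)^{K - (n - n')} (x - i)^{K + (n - n')}`.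
  have h1 := h.sum_nonneg F (fun n => ⟨0, K 0 - n 0, n 0, 0, K 1 - n 1, n 1⟩) β
  convert! h1 using 1
  refine Finset.sum_congr rfl fun a _ => Finset.sum_congr rfl fun b _ => ?_
  congr 1
  refine congrArg u ?_
  ext <;> simp [torusIndex, Index.pair] <;> ring

namespace LinearRelations

theorem succK_eq (h : LinearRelations u) (w : Index) :
    u w.succK = u w.succM + Complex.I * u w := by
  simpa only [Index.pair_zero] using (h.rel_k w Index.zero).symm

theorem succL_eq (h : LinearRelations u) (w : Index) :
    u w.succL = u w.succM - Complex.I * u w := by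
  simpa only [Index.pair_zero] using (h.rel_l w Index.zero).symm

theorem succR_eq (h : LinearRelations u) (w : Index) :
    u w.succR = u w.succN + Complex.I * u w := by
  simpa only [Index.pair_zero] using (h.rel_r w Index.zero).symm

theorem succT_eq (h : LinearRelations u) (w : Index) :
    u w.succT = u w.succN - Complex.I * u w := by
  simpa only [Index.pair_zero] using (h.rel_t w Index.zero).symm

/-- The relation `4 = 2 (x + i) (x - i) - (x - i)² - (x + i)²` in the first variable. -/
theorem four_mul_fst (h : LinearRelations u) (w : Index) :
    4 * u w = 2 * u w.succK.succL - u w.succL.succL - u w.succK.succK := by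
  have hI := Complex.I_sq
  rw [show w.succK.succL = w.succL.succK from rfl]
  have e1 := h.succK_eq w
  have e2 := h.succL_eq w
  have e3 := h.succK_eq w.succK
  have e4 := h.succL_eq w.succK
  have e5 := h.succK_eq w.succL
  have e6 := h.succL_eq w.succL
  rw [show w.succK.succL = w.succL.succK from rfl] at e4
  linear_combination (-2 : ℂ) * e5 + e6 + e3 + (e5 - e4) +
    2 * Complex.I * e1 - 2 * Complex.I * e2 + 4 * u w * hI

theorem four_mul_snd (h : LinearRelations u) (w : Index) :
    4 * u w = 2 * u w.succR.succT - u w.succT.succT - u w.succR.succR := by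
  have hI := Complex.I_sq
  rw [show w.succR.succT = w.succT.succR from rfl]
  have e1 := h.succR_eq w
  have e2 := h.succT_eq w
  have e3 := h.succR_eq w.succR
  have e4 := h.succT_eq w.succR
  have e5 := h.succR_eq w.succT
  have e6 := h.succT_eq w.succT
  rw [show w.succR.succT = w.succT.succR from rfl] at e4
  linear_combination (-2 : ℂ) * e5 + e6 + e3 + (e5 - e4) +
    2 * Complex.I * e1 - 2 * Complex.I * e2 + 4 * u w * hI

theorem torusIndex_rel (h : LinearRelations u) (K : Fin 2 → ℤ) (i : Fin 2) (n : Fin 2 → ℤ) :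
    4 * u (torusIndex K n) = 2 * u (torusIndex (K + Pi.single i 1) n) -
      u (torusIndex (K + Pi.single i 1) (n + Pi.single i 1)) -
      u (torusIndex (K + Pi.single i 1) (n - Pi.single i 1)) := by
  fin_cases i
  · rw [h.four_mul_fst]
    congr 3
    all_goals try congr 1
    all_goals
      ext <;> simp [torusIndex, Index.succK, Index.succL] <;> ring
  · rw [h.four_mul_snd]
    congr 3
    all_goals try congr 1
    all_goals
      ext <;> simp [torusIndex, Index.succR, Index.succT] <;> ring

end LinearRelations

/-- The measure `μ` has the prescribed moment with index `w`. -/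
def HasMoment (u : Index → ℂ) (μ : Measure (ℝ × ℝ)) (w : Index) : Prop :=
  Integrable (monomial w) μ ∧ ∫ p, monomial w p ∂μ = u w

theorem HasMoment.linear {w w₁ w₂ : Index} {a b : ℂ} (h₁ : HasMoment u μ w₁)
    (h₂ : HasMoment u μ w₂) (hm : ∀ p, monomial w p = a * monomial w₁ p + b * monomial w₂ p)
    (hu : u w = a * u w₁ + b * u w₂) : HasMoment u μ w := by
  have hi₁ := h₁.1.const_mul a
  have hi₂ := h₂.1.const_mul b
  refine ⟨(hi₁.add hi₂).congr (Eventually.of_forall fun p => (hm p).symm), ?_⟩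
  simp_rw [hm]
  rw [integral_add hi₁ hi₂, integral_const_mul, integral_const_mul, h₁.2, h₂.2, hu]

/-- By the linear relations, all moments are determined by those of the even indices without
powers of `x₁` and `x₂`. -/
theorem LinearRelations.isSolution (h : LinearRelations u)
    (hμ : ∀ K n, HasMoment u μ (torusIndex K n)) : IsSolution u μ := by
  have hI := Complex.I_sq
  have hI0 := Complex.I_ne_zero
  have hM : ∀ w : Index, HasMoment u μ w.succK → HasMoment u μ w → HasMoment u μ w.succM := by
    intro w h1 h2
    refine h1.linear (a := 1) (b := -Complex.I) h2 (fun p => ?_) ?_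
    · rw [monomial_succK, monomial_succM]
      ring
    · rw [h.succK_eq]
      ring
  have hN : ∀ w : Index, HasMoment u μ w.succR → HasMoment u μ w → HasMoment u μ w.succN := by
    intro w h1 h2
    refine h1.linear (a := 1) (b := -Complex.I) h2 (fun p => ?_) ?_
    · rw [monomial_succR, monomial_succN]
      ring
    · rw [h.succR_eq]
      ring
  -- Odd exponents reduce to even ones by `(x + i) - (x - i) = 2i`.
  have hKL : ∀ w : Index, HasMoment u μ w.succK → HasMoment u μ w.succL → HasMoment u μ w := by
    intro w h1 h2
    refine h1.linear (a := -Complex.I / 2) (b := Complex.I / 2) h2 (fun p => ?_) ?_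
    · rw [monomial_succK, monomial_succL]
      linear_combination monomial w p * hI
    · rw [h.succK_eq, h.succL_eq]
      linear_combination u w * hI
  have hRT : ∀ w : Index, HasMoment u μ w.succR → HasMoment u μ w.succT → HasMoment u μ w := by
    intro w h1 h2
    refine h1.linear (a := -Complex.I / 2) (b := Complex.I / 2) h2 (fun p => ?_) ?_
    · rw [monomial_succR, monomial_succT]
      linear_combination monomial w p * hI
    · rw [h.succR_eq, h.succT_eq]
      linear_combination u w * hI
  have h0 : ∀ k l r t : ℤ, Even (k + l) → Even (r + t) → HasMoment u μ ⟨0, k, l, 0, r, t⟩ := by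
    rintro k l r t ⟨a, ha⟩ ⟨b, hb⟩
    convert! hμ ![a, b] ![l - a, t - b] using 1
    ext <;> simp [torusIndex] <;> omega
  have h1 : ∀ k l r t : ℤ, Even (k + l) → HasMoment u μ ⟨0, k, l, 0, r, t⟩ := by
    intro k l r t hkl
    rcases Int.even_or_odd (r + t) with hrt | hrt
    · exact h0 k l r t hkl hrt
    · exact hRT _ (h0 k l (r + 1) t hkl (by grind)) (h0 k l r (t + 1) hkl (by grind))
  have h2 : ∀ k l r t : ℤ, HasMoment u μ ⟨0, k, l, 0, r, t⟩ := by
    intro k l r t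
    rcases Int.even_or_odd (k + l) with hkl | hkl
    · exact h1 k l r t hkl
    · exact hKL _ (h1 (k + 1) l r t (by grind)) (h1 k (l + 1) r t (by grind))
  have h3 : ∀ (m : ℕ) (k l r t : ℤ), HasMoment u μ ⟨m, k, l, 0, r, t⟩ := by
    intro m
    induction m with
    | zero => exact h2
    | succ m ih => exact fun k l r t => hM ⟨m, k, l, 0, r, t⟩ (ih (k + 1) l r t) (ih k l r t)
  have h4 : ∀ (n m : ℕ) (k l r t : ℤ), HasMoment u μ ⟨m, k, l, n, r, t⟩ := by
    intro n
    induction n with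
    | zero => exact h3
    | succ n ih =>
      exact fun m k l r t => hN ⟨m, k, l, n, r, t⟩ (ih m k l (r + 1) t) (ih m k l r t)
  exact fun w => h4 w.n w.m w.k w.l w.r w.t

theorem exists_isSolution (hp : IsPositive u) (hl : LinearRelations u) :
    ∃ μ : Measure (ℝ × ℝ), IsSolution u μ := by
  obtain ⟨ν, hfin, hne, hν⟩ := exists_weighted_measure (c := fun K n => u (torusIndex K n))
    hp.isPosDef hl.torusIndex_rel
  refine ⟨ν.map toPlane, hl.isSolution fun K n => ?_⟩
  have hae : (fun x => ((∏ i, weight (x i) ^ (-K i) : ℝ) : ℂ) * mFourier n x) =ᵐ[ν]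
      fun x => monomial (torusIndex K n) (toPlane x) := by
    filter_upwards [ae_all_iff.2 hne] with x hx
    rw [monomial_torusIndex K n x hx]
  obtain ⟨h1, h2⟩ := hν K n
  have hm := (measurable_monomial (torusIndex K n)).aestronglyMeasurable (μ := ν.map toPlane)
  constructor
  · rw [integrable_map_measure hm measurable_toPlane.aemeasurable]
    exact h1.congr hae
  · rw [integral_map measurable_toPlane.aemeasurable hm, ← h2]
    exact integral_congr_ae hae.symm

/-! ### Uniqueness of the solution and density of the monomials -/

theorem IsSolution.unique (h : IsSolution u μ) (h' : IsSolution u μ') : μ = μ' := by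
  have := h.isFiniteMeasure
  have := h'.isFiniteMeasure
  have h1 : μ.map toTorus = μ'.map toTorus := by
    refine measure_ext_of_integral_mFourier fun n => ?_
    rw [integral_map measurable_toTorus.aemeasurable
        (map_continuous (mFourier n)).aestronglyMeasurable,
      integral_map measurable_toTorus.aemeasurable
        (map_continuous (mFourier n)).aestronglyMeasurable]
    simp_rw [← monomial_torusIndex_zero]
    rw [(h _).2, (h' _).2]
  have h2 : ∀ ρ : Measure (ℝ × ℝ), (ρ.map toTorus).map toPlane = ρ := by
    intro ρ
    rw [Measure.map_map measurable_toPlane measurable_toTorus,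
      show toPlane ∘ toTorus = id from funext toPlane_toTorus, Measure.map_id]
  rw [← h2 μ, h1, h2]

theorem IsSolution.memLp_monomial (h : IsSolution u μ) (w : Index) : MemLp (monomial w) 2 μ := by
  rw [memLp_two_iff_integrable_sq_norm (measurable_monomial w).aestronglyMeasurable]
  have h1 := (h (w.pair w)).1.re
  refine h1.congr (Eventually.of_forall fun p => ?_)
  simp only [monomial_pair, Complex.mul_conj, Complex.normSq_eq_norm_sq, RCLike.re_to_complex,
    Complex.ofReal_re]

/-- The products of integer powers of the Cayley transforms already span a dense subspace: they are
the characters of the torus. -/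
theorem IsSolution.dense_monomial (h : IsSolution u μ) :
    (Submodule.span ℂ (Set.range fun w => (h.memLp_monomial w).toLp)).topologicalClosure = ⊤ := by
  have := h.isFiniteMeasure
  have hT : MeasurePreserving toTorus μ (μ.map toTorus) := measurable_toTorus.measurePreserving μ
  let C : Lp ℂ 2 (μ.map toTorus) →L[ℂ] Lp ℂ 2 μ :=
    (Lp.compMeasurePreservingₗᵢ ℂ toTorus hT).toContinuousLinearMap
  have hC : Function.Surjective C := by
    intro f
    have hP : MeasurePreserving toPlane (μ.map toTorus) μ :=
      ⟨measurable_toPlane, by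
        rw [Measure.map_map measurable_toPlane measurable_toTorus,
          show toPlane ∘ toTorus = id from funext toPlane_toTorus, Measure.map_id]⟩
    refine ⟨Lp.compMeasurePreserving toPlane hP f, ?_⟩
    refine Lp.ext ?_
    have h1 := Lp.coeFn_compMeasurePreserving (Lp.compMeasurePreserving toPlane hP f) hT
    have h2 := hT.quasiMeasurePreserving.ae_eq_comp (Lp.coeFn_compMeasurePreserving f hP)
    refine h1.trans (h2.trans (Eventually.of_forall fun p => ?_))
    simp [toPlane_toTorus]
  have hd := (ContinuousMap.toLp_denseRange ℂ (μ.map toTorus) ℂ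
    (p := 2) (by simp)).topologicalClosure_map_submodule (span_mFourier_closure_eq_top (d := Fin 2))
  have hd' := hC.denseRange.topologicalClosure_map_submodule hd
  rw [eq_top_iff, ← hd']
  refine Submodule.topologicalClosure_mono ?_
  rw [Submodule.map_span, Submodule.map_span, Submodule.span_le]
  rintro _ ⟨_, ⟨_, ⟨n, rfl⟩, rfl⟩, rfl⟩
  refine Submodule.subset_span ⟨torusIndex 0 n, ?_⟩
  refine Lp.ext ((MemLp.coeFn_toLp _).trans ?_)
  have h1 := Lp.coeFn_compMeasurePreserving
    (ContinuousMap.toLp (E := ℂ) 2 (μ.map toTorus) ℂ (mFourier n)) hT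
  have h2 := hT.quasiMeasurePreserving.ae_eq_comp
    (ContinuousMap.coeFn_toLp (𝕜 := ℂ) (p := 2) (μ.map toTorus) (mFourier n))
  refine ((h1.trans h2).trans (Eventually.of_forall fun p => ?_)).symm
  exact (monomial_torusIndex_zero n p).symm

end Moments

/-! ### Isometries determined by Gram matrices -/

section Gram

variable {ι H K : Type*} [NormedAddCommGroup H] [InnerProductSpace ℂ H] [NormedAddCommGroup K]
  [InnerProductSpace ℂ K] [CompleteSpace K]

theorem exists_linearIsometry_of_gram {x : ι → H} {y : ι → K}
    (hg : ∀ i j, inner ℂ (x i) (x j) = inner ℂ (y i) (y j))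
    (hx : (Submodule.span ℂ (Set.range x)).topologicalClosure = ⊤) :
    ∃ W : H →ₗᵢ[ℂ] K, ∀ i, W (x i) = y i := by
  let e : (ι →₀ ℂ) →ₗ[ℂ] H := Finsupp.linearCombination ℂ x
  let f : (ι →₀ ℂ) →ₗ[ℂ] K := Finsupp.linearCombination ℂ y
  have hin : ∀ a, inner ℂ (f a) (f a) = inner ℂ (e a) (e a) := by
    intro a
    simp only [e, f, Finsupp.linearCombination_apply, Finsupp.sum_inner, Finsupp.inner_sum,
      inner_smul_left, inner_smul_right, hg]
  have hnorm : ∀ a, ‖f a‖ = ‖e a‖ := fun a => by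
    rw [norm_eq_sqrt_re_inner (𝕜 := ℂ), hin, ← norm_eq_sqrt_re_inner]
  have hd : DenseRange e := by
    rw [DenseRange, ← LinearMap.coe_range, Finsupp.range_linearCombination,
      Submodule.dense_iff_topologicalClosure_eq_top]
    exact hx
  have hb : ∃ C : ℝ, ∀ a, ‖f a‖ ≤ C * ‖e a‖ := ⟨1, fun a => by rw [one_mul, hnorm]⟩
  refine ⟨⟨(f.extendOfNorm e).toLinearMap, fun h => ?_⟩, fun i => ?_⟩
  · refine hd.induction_on (p := fun h => ‖f.extendOfNorm e h‖ = ‖h‖) h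
      (isClosed_eq (by fun_prop) (by fun_prop)) fun a => ?_
    rw [LinearMap.extendOfNorm_eq hd hb, hnorm]
  · change f.extendOfNorm e (x i) = y i
    have h1 : e (Finsupp.single i 1) = x i := by simp [e]
    rw [← h1, LinearMap.extendOfNorm_eq hd hb]
    simp [f]

theorem exists_linearIsometryEquiv_of_gram [CompleteSpace H] {x : ι → H} {y : ι → K}
    (hg : ∀ i j, inner ℂ (x i) (x j) = inner ℂ (y i) (y j))
    (hx : (Submodule.span ℂ (Set.range x)).topologicalClosure = ⊤)
    (hy : (Submodule.span ℂ (Set.range y)).topologicalClosure = ⊤) :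
    ∃ W : H ≃ₗᵢ[ℂ] K, ∀ i, W (x i) = y i := by
  obtain ⟨W, hW⟩ := exists_linearIsometry_of_gram hg hx
  have hcl : IsClosed (LinearMap.range W.toLinearMap : Set K) := by
    rw [LinearMap.coe_range]
    exact W.isometry.isClosedEmbedding.isClosed_range
  have htop : LinearMap.range W.toLinearMap = ⊤ := by
    rw [eq_top_iff, ← hy]
    refine Submodule.topologicalClosure_minimal _ ?_ hcl
    rw [Submodule.span_le]
    rintro _ ⟨i, rfl⟩
    exact ⟨x i, hW i⟩
  exact ⟨LinearIsometryEquiv.ofSurjective W (LinearMap.range_eq_top.1 htop), hW⟩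

end Gram

/-! ### Multiplication operators on `L²` -/

section Mul

variable {X : Type*} [MeasurableSpace X] {μ : Measure X}

/-- Multiplication by an essentially bounded function on `L²`. -/
noncomputable def mulOp (φ : X → ℂ) (hφ : MemLp φ ∞ μ) : Lp ℂ 2 μ →L[ℂ] Lp ℂ 2 μ :=
  (ContinuousLinearMap.mul ℂ ℂ).holderL μ ∞ 2 2 hφ.toLp

theorem mulOp_coeFn {φ : X → ℂ} (hφ : MemLp φ ∞ μ) (g : Lp ℂ 2 μ) :
    mulOp φ hφ g =ᵐ[μ] fun p => φ p * g p := by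
  have h1 := (ContinuousLinearMap.mul ℂ ℂ).coeFn_holder (r := 2) hφ.toLp g
  filter_upwards [h1, hφ.coeFn_toLp] with p hp hp'
  change ((ContinuousLinearMap.mul ℂ ℂ).holder 2 hφ.toLp g) p = _
  rw [hp, hp']
  rfl

theorem memLp_top_indicator {s : Set X} (hs : MeasurableSet s) :
    MemLp (s.indicator fun _ => (1 : ℂ)) ∞ μ :=
  memLp_top_of_bound ((measurable_const.indicator hs).aestronglyMeasurable) 1
    (Eventually.of_forall fun p => by by_cases h : p ∈ s <;> simp [h])

theorem inner_mulOp_left {φ ψ : X → ℂ} (hφ : MemLp φ ∞ μ) (hψ : MemLp ψ ∞ μ)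
    (h : ∀ p, ψ p = starRingEnd ℂ (φ p)) (g g' : Lp ℂ 2 μ) :
    inner ℂ (mulOp φ hφ g) g' = inner ℂ g (mulOp ψ hψ g') := by
  rw [L2.inner_def, L2.inner_def]
  refine integral_congr_ae ?_
  filter_upwards [mulOp_coeFn hφ g, mulOp_coeFn hψ g'] with p h1 h2
  rw [h1, h2, h p]
  simp only [RCLike.inner_apply, map_mul]
  ring

/-- The measure `|g|² μ`. -/
noncomputable def sqDensity (μ : Measure X) (g : X → ℂ) : Measure X :=
  μ.withDensity fun p => ‖g p‖ₑ ^ 2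

theorem ofReal_inner_mulOp_indicator (g : Lp ℂ 2 μ) {s : Set X} (hs : MeasurableSet s) :
    ENNReal.ofReal (inner ℂ g (mulOp _ (memLp_top_indicator hs) g)).re = sqDensity μ g s := by
  have h1 : inner ℂ g (mulOp _ (memLp_top_indicator hs) g) =
      ((∫ p in s, ‖g p‖ ^ 2 ∂μ : ℝ) : ℂ) := by
    rw [L2.inner_def, ← integral_complex_ofReal, ← integral_indicator hs]
    refine integral_congr_ae ?_
    filter_upwards [mulOp_coeFn (memLp_top_indicator hs) g] with p hp
    rw [hp]
    by_cases hps : p ∈ s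
    · simp [hps]
    · simp [hps]
  have h2 : Integrable (fun p => ‖g p‖ ^ 2) μ :=
    (memLp_two_iff_integrable_sq_norm (Lp.memLp g).1).1 (Lp.memLp g)
  rw [h1, Complex.ofReal_re, sqDensity, withDensity_apply _ hs,
    ofReal_integral_eq_lintegral_ofReal h2.integrableOn
      (Eventually.of_forall fun p => by positivity)]
  refine lintegral_congr fun p => ?_
  rw [ENNReal.ofReal_pow (norm_nonneg _), ofReal_norm]

theorem eLpNorm_sqDensity {g : X → ℂ} (hg : Measurable g) {ψ : X → ℂ} (hψ : Measurable ψ) :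
    eLpNorm ψ 2 (sqDensity μ g) = eLpNorm (fun p => ψ p * g p) 2 μ := by
  have h : ∀ (ρ : Measure X) (χ : X → ℂ), eLpNorm χ 2 ρ = (∫⁻ p, ‖χ p‖ₑ ^ 2 ∂ρ) ^ (1 / 2 : ℝ) := by
    intro ρ χ
    rw [eLpNorm_eq_lintegral_rpow_enorm_toReal (by simp) (by simp)]
    simp
  rw [h, h, sqDensity, lintegral_withDensity_eq_lintegral_mul _ (by fun_prop) (by fun_prop)]
  congr 1
  refine lintegral_congr fun p => ?_
  rw [Pi.mul_apply, enorm_mul, mul_pow, mul_comm]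

theorem memLp_sqDensity_iff {g : X → ℂ} (hg : Measurable g) {ψ : X → ℂ} (hψ : Measurable ψ) :
    MemLp ψ 2 (sqDensity μ g) ↔ MemLp (fun p => ψ p * g p) 2 μ := by
  have h : AEStronglyMeasurable (fun p => ψ p * g p) μ := (hψ.mul hg).aestronglyMeasurable
  simp only [MemLp, eLpNorm_sqDensity hg hψ, hψ.aestronglyMeasurable, h, true_and]

theorem memLp_ofReal_iff {ρ : Measure X} {f : X → ℝ} (hf : Measurable f) :
    MemLp f 2 ρ ↔ MemLp (fun p => (f p : ℂ)) 2 ρ := by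
  have hf' : Measurable fun p => (f p : ℂ) := by fun_prop
  simp only [MemLp, hf.aestronglyMeasurable, hf'.aestronglyMeasurable, true_and]
  rw [eLpNorm_congr_norm_ae (g := f) (f := fun p => (f p : ℂ))
    (Eventually.of_forall fun p => Complex.norm_real _)]

end Mul

/-! ### Multiplication by an unbounded real function -/

section Transport

variable {X : Type*} [MeasurableSpace X] {μ : Measure X} {H : Type*} [NormedAddCommGroup H]
  [InnerProductSpace ℂ H] (W : H ≃ₗᵢ[ℂ] Lp ℂ 2 μ)

/-- Multiplication by a bounded function, transported to `H` along a unitary map `W`. -/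
noncomputable def transMul (φ : X → ℂ) (hφ : MemLp φ ∞ μ) : H →L[ℂ] H :=
  (W.symm.toContinuousLinearEquiv : Lp ℂ 2 μ →L[ℂ] H) ∘L mulOp φ hφ ∘L
    (W.toContinuousLinearEquiv : H →L[ℂ] Lp ℂ 2 μ)

variable {W}

theorem apply_transMul {φ : X → ℂ} (hφ : MemLp φ ∞ μ) (h : H) :
    W (transMul W φ hφ h) = mulOp φ hφ (W h) :=
  W.apply_symm_apply _

theorem apply_transMul_ae {φ : X → ℂ} (hφ : MemLp φ ∞ μ) (h : H) :
    W (transMul W φ hφ h) =ᵐ[μ] fun p => φ p * W h p := by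
  rw [apply_transMul]
  exact mulOp_coeFn hφ _

theorem eq_of_apply_ae {h h' : H} (hh : W h =ᵐ[μ] W h') : h = h' :=
  W.injective (Lp.ext hh)

theorem transMul_commute {φ ψ : X → ℂ} (hφ : MemLp φ ∞ μ) (hψ : MemLp ψ ∞ μ) :
    transMul W φ hφ ∘L transMul W ψ hψ = transMul W ψ hψ ∘L transMul W φ hφ := by
  ext k
  refine eq_of_apply_ae (W := W) ?_
  filter_upwards [apply_transMul_ae hφ (transMul W ψ hψ k), apply_transMul_ae (W := W) hψ k,
    apply_transMul_ae hψ (transMul W φ hφ k), apply_transMul_ae (W := W) hφ k] with p h1 h2 h3 h4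
  rw [ContinuousLinearMap.comp_apply, ContinuousLinearMap.comp_apply, h1, h2, h3, h4,
    mul_left_comm]

theorem inner_transMul_left {φ ψ : X → ℂ} (hφ : MemLp φ ∞ μ) (hψ : MemLp ψ ∞ μ)
    (h : ∀ p, ψ p = starRingEnd ℂ (φ p)) (k k' : H) :
    inner ℂ (transMul W φ hφ k) k' = inner ℂ k (transMul W ψ hψ k') := by
  rw [← W.inner_map_map, ← W.inner_map_map k, apply_transMul, apply_transMul,
    inner_mulOp_left hφ hψ h]

variable (W) in
/-- The graph of multiplication by a real function `f`, transported to `H` along `W`: the pairs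
`(h, h')` with `W h' = f W h`. -/
def mulGraph (f : X → ℝ) : Submodule ℂ (H × H) where
  carrier := {q | W q.2 =ᵐ[μ] fun p => (f p : ℂ) * W q.1 p}
  zero_mem' := by
    change W (0 : H) =ᵐ[μ] fun p => (f p : ℂ) * W (0 : H) p
    rw [map_zero]
    filter_upwards [Lp.coeFn_zero ℂ 2 μ] with p hp
    rw [hp, Pi.zero_apply, mul_zero]
  add_mem' := by
    intro a b ha hb
    simp only [Set.mem_ofPred_eq, Prod.snd_add, Prod.fst_add, map_add] at *
    filter_upwards [ha, hb, Lp.coeFn_add (W a.1) (W b.1), Lp.coeFn_add (W a.2) (W b.2)]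
      with p h1 h2 h3 h4
    rw [h3, h4, Pi.add_apply, Pi.add_apply, h1, h2, mul_add]
  smul_mem' := by
    intro c a ha
    change W (c • a.2) =ᵐ[μ] fun p => (f p : ℂ) * W (c • a.1) p
    rw [map_smul, map_smul]
    filter_upwards [ha, Lp.coeFn_smul c (W a.1), Lp.coeFn_smul c (W a.2)] with p h1 h2 h3
    rw [h2, h3, Pi.smul_apply, Pi.smul_apply, h1, smul_eq_mul, smul_eq_mul, mul_left_comm]

variable {f : X → ℝ}

theorem mem_mulGraph {h h' : H} :
    (h, h') ∈ mulGraph W f ↔ W h' =ᵐ[μ] fun p => (f p : ℂ) * W h p := Iff.rfl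

theorem mulGraph_unique {q : H × H} (hq : q ∈ mulGraph W f) (h0 : q.1 = 0) : q.2 = 0 := by
  refine eq_of_apply_ae (W := W) ?_
  have h1 : W q.2 =ᵐ[μ] fun p => (f p : ℂ) * W q.1 p := hq
  rw [h0, map_zero] at h1
  rw [map_zero]
  filter_upwards [h1, Lp.coeFn_zero ℂ 2 μ] with p h2 h3
  rw [h2, h3, Pi.zero_apply, mul_zero]

theorem ofReal_sub_ne_zero {z : ℂ} (hz : z.im ≠ 0) (x : ℝ) : (x : ℂ) - z ≠ 0 := fun h => by
  have := congrArg Complex.im h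
  simp only [Complex.sub_im, Complex.ofReal_im, zero_sub, Complex.zero_im, neg_eq_zero] at this
  exact hz this

theorem memLp_resolvent (hf : Measurable f) {z : ℂ} (hz : z.im ≠ 0) :
    MemLp (fun p => ((f p : ℂ) - z)⁻¹) ∞ μ := by
  refine memLp_top_of_bound (by fun_prop : Measurable _).aestronglyMeasurable (|z.im|⁻¹)
    (Eventually.of_forall fun p => ?_)
  rw [norm_inv]
  refine inv_anti₀ (abs_pos.2 hz) ?_
  simpa using Complex.abs_im_le_norm ((f p : ℂ) - z)

/-- The graph of multiplication by `f` in terms of its resolvent. -/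
theorem mem_mulGraph_iff_resolvent (hf : Measurable f) {z : ℂ} (hz : z.im ≠ 0) {h h' : H} :
    (h, h') ∈ mulGraph W f ↔ transMul W _ (memLp_resolvent hf hz) (h' - z • h) = h := by
  have hs : W (h' - z • h) =ᵐ[μ] fun p => W h' p - z * W h p := by
    rw [map_sub, map_smul]
    filter_upwards [Lp.coeFn_sub (W h') (z • W h), Lp.coeFn_smul z (W h)] with p h1 h2
    rw [h1, Pi.sub_apply, h2, Pi.smul_apply, smul_eq_mul]
  have hR := apply_transMul_ae (W := W) (memLp_resolvent hf hz) (h' - z • h)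
  rw [mem_mulGraph]
  constructor
  · intro hm
    refine eq_of_apply_ae (W := W) ?_
    filter_upwards [hs, hR, hm] with p h1 h2 h3
    rw [h2, h1, h3, ← sub_mul, inv_mul_cancel_left₀ (ofReal_sub_ne_zero hz _)]
  · intro hm
    rw [hm] at hR
    filter_upwards [hs, hR] with p h1 h2
    rw [h1, eq_inv_mul_iff_mul_eq₀ (ofReal_sub_ne_zero hz _)] at h2
    linear_combination -h2

theorem isClosed_mulGraph (hf : Measurable f) : IsClosed (mulGraph W f : Set (H × H)) := by
  have hz : Complex.I.im ≠ 0 := by simp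
  have h1 : (mulGraph W f : Set (H × H)) = {q | transMul W _ (memLp_resolvent (μ := μ) hf hz)
      (q.2 - Complex.I • q.1) = q.1} := by
    ext ⟨h, h'⟩
    exact mem_mulGraph_iff_resolvent hf hz
  rw [h1]
  exact isClosed_eq (by fun_prop) (by fun_prop)

theorem isResolventAt_of_graph {T : H →ₗ.[ℂ] H} (hT : T.graph = mulGraph W f) (hf : Measurable f)
    {z : ℂ} (hz : z.im ≠ 0) : IsResolventAt T z (transMul W _ (memLp_resolvent hf hz)) := by
  set R := transMul W _ (memLp_resolvent (μ := μ) hf hz)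
  constructor
  · intro y
    have h1 : (R y, y + z • R y) ∈ T.graph := by
      rw [hT, mem_mulGraph_iff_resolvent hf hz, add_sub_cancel_right]
    obtain ⟨h, h2⟩ := (LinearPMap.mem_graph_iff _).1 h1
    simp only at h2
    refine ⟨h2.1 ▸ h.2, ?_⟩
    have h3 : (⟨R y, h2.1 ▸ h.2⟩ : T.domain) = h := Subtype.ext h2.1.symm
    rw [h3, h2.2, add_sub_cancel_right]
  · intro y
    have h1 : ((y : H), T y) ∈ T.graph := T.mem_graph y
    rwa [hT, mem_mulGraph_iff_resolvent hf hz] at h1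

/-- Multiplication by a real function is self-adjoint, since its resolvents at conjugate points
are adjoint to each other. -/
theorem isSelfAdjoint_of_graph [CompleteSpace H] {T : H →ₗ.[ℂ] H} (hd : Dense (T.domain : Set H))
    (hT : T.graph = mulGraph W f) (hf : Measurable f) : IsSelfAdjoint T := by
  have hI : Complex.I.im ≠ 0 := by simp
  have hI' : (-Complex.I).im ≠ 0 := by simp
  set R := transMul W _ (memLp_resolvent (μ := μ) hf hI) with hR
  set R' := transMul W _ (memLp_resolvent (μ := μ) hf hI') with hR'
  have hadj : ∀ k k', inner ℂ (R k) k' = inner ℂ k (R' k') := by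
    refine inner_transMul_left _ _ fun p => ?_
    simp
  rw [LinearPMap.isSelfAdjoint_def]
  refine LinearPMap.eq_of_eq_graph ?_
  rw [LinearPMap.adjoint_graph_eq_graph_adjoint hd]
  ext ⟨c, e⟩
  rw [Submodule.mem_adjoint_iff]
  conv_rhs => rw [hT, mem_mulGraph_iff_resolvent hf hI', ← hR']
  constructor
  · intro h
    refine ext_inner_left ℂ fun y => ?_
    have h1 := h (R y) (y + Complex.I • R y)
      (by rw [hT, mem_mulGraph_iff_resolvent hf hI, add_sub_cancel_right])
    simp only [inner_add_left, inner_smul_left, Complex.conj_I] at h1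
    rw [← hadj, inner_sub_right, inner_smul_right]
    linear_combination -h1
  · intro h a b hab
    rw [hT, mem_mulGraph_iff_resolvent hf hI, ← hR] at hab
    have h1 := hadj (b - Complex.I • a) (e - (-Complex.I) • c)
    rw [h, hab] at h1
    simp only [inner_sub_left, inner_sub_right, inner_smul_left, inner_smul_right,
      Complex.conj_I] at h1
    simp only
    linear_combination -h1

variable (W) in
/-- Multiplication by the indicator function of `s`, transported to `H` along `W`. On non-measurable
sets the value is the junk value `0`. -/
noncomputable def transProj (s : Set X) : H →L[ℂ] H := by
  classical exact if hs : MeasurableSet s then transMul W _ (memLp_top_indicator hs) else 0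

theorem transProj_of_measurable {s : Set X} (hs : MeasurableSet s) :
    transProj W s = transMul W _ (memLp_top_indicator hs) := dif_pos hs

theorem transProj_ae {s : Set X} (hs : MeasurableSet s) (h : H) :
    W (transProj W s h) =ᵐ[μ] s.indicator (W h) := by
  rw [transProj_of_measurable hs]
  filter_upwards [apply_transMul_ae (W := W) (memLp_top_indicator hs) h] with p hp
  rw [hp]
  by_cases hps : p ∈ s <;> simp [hps]

theorem transProj_inter {s t : Set X} (hs : MeasurableSet s) (ht : MeasurableSet t) :
    transProj W (s ∩ t) = transProj W s * transProj W t := by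
  ext h
  refine eq_of_apply_ae (W := W) ?_
  rw [mul_apply_eq_comp]
  filter_upwards [transProj_ae (W := W) (hs.inter ht) h, transProj_ae hs (transProj W t h),
    transProj_ae (W := W) ht h] with p h1 h2 h3
  rw [h1, h2]
  by_cases hps : p ∈ s <;> by_cases hpt : p ∈ t <;> simp [hps, hpt, h3]

theorem transProj_union {s t : Set X} (hs : MeasurableSet s) (ht : MeasurableSet t)
    (hd : Disjoint s t) (h : H) :
    transProj W (s ∪ t) h = transProj W s h + transProj W t h := by
  refine eq_of_apply_ae (W := W) ?_
  rw [map_add]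
  filter_upwards [transProj_ae (W := W) (hs.union ht) h, transProj_ae (W := W) hs h,
    transProj_ae (W := W) ht h,
    Lp.coeFn_add (W (transProj W s h)) (W (transProj W t h))] with p h1 h2 h3 h4
  rw [h1, h4, Pi.add_apply, h2, h3, Set.indicator_union_of_disjoint hd]

theorem ofReal_inner_transProj (h : H) {s : Set X} (hs : MeasurableSet s) :
    ENNReal.ofReal (inner ℂ h (transProj W s h)).re = sqDensity μ (W h) s := by
  rw [← ofReal_inner_mulOp_indicator (W h) hs, ← W.inner_map_map, transProj_of_measurable hs,
    apply_transMul]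

theorem isStarProjection_transProj [CompleteSpace H] {s : Set X} (hs : MeasurableSet s) :
    IsStarProjection (transProj W s) := by
  refine ⟨?_, ?_⟩
  · rw [IsIdempotentElem, ← transProj_inter hs hs, Set.inter_self]
  · rw [ContinuousLinearMap.isSelfAdjoint_iff_isSymmetric]
    intro k k'
    simp only [ContinuousLinearMap.coe_coe]
    rw [transProj_of_measurable hs]
    refine inner_transMul_left _ _ (fun p => ?_) k k'
    by_cases hps : p ∈ s <;> simp [hps]

theorem norm_transProj_sq [CompleteSpace H] (h : H) {s : Set X} (hs : MeasurableSet s) :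
    ENNReal.ofReal (‖transProj W s h‖ ^ 2) = sqDensity μ (W h) s := by
  have hp := isStarProjection_transProj (W := W) hs
  have hid : transProj W s (transProj W s h) = transProj W s h := by
    rw [← mul_apply_eq_comp, hp.isIdempotentElem.eq]
  have hsym : inner ℂ (transProj W s h) (transProj W s h) =
      inner ℂ h (transProj W s (transProj W s h)) :=
    ContinuousLinearMap.isSelfAdjoint_iff_isSymmetric.1 hp.isSelfAdjoint h (transProj W s h)
  rw [hid, inner_self_eq_norm_sq_to_K] at hsym
  rw [← ofReal_inner_transProj h hs, ← hsym]
  norm_cast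

variable (W) in
/-- The spectral measure of multiplications by indicator functions, transported to `H` along `W`. -/
noncomputable def transSpectral [CompleteSpace H] : SpectralMeasure X H where
  proj := transProj W
  isStarProjection _ hs := isStarProjection_transProj hs
  univ := by
    ext h
    refine eq_of_apply_ae (W := W) ?_
    filter_upwards [transProj_ae (W := W) MeasurableSet.univ h] with p hp
    rw [hp]
    simp
  inter _ _ hs ht := transProj_inter hs ht
  iUnion := by
    intro s hs hd h
    have hU : MeasurableSet (⋃ j, s j) := MeasurableSet.iUnion hs
    have hfinU : ∀ F : Finset ℕ, MeasurableSet (⋃ j ∈ F, s j) := fun F =>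
      F.measurableSet_biUnion fun j _ => hs j
    have hsum : ∀ F : Finset ℕ, transProj W (⋃ j ∈ F, s j) h = ∑ j ∈ F, transProj W (s j) h := by
      intro F
      induction F using Finset.induction_on with
      | empty =>
        refine eq_of_apply_ae (W := W) ?_
        filter_upwards [transProj_ae (W := W) (hfinU ∅) h, Lp.coeFn_zero ℂ 2 μ] with p h1 h2
        simp only [Finset.sum_empty, map_zero]
        rw [h1, h2]
        simp
      | insert a F ha ih =>
        rw [Finset.set_biUnion_insert, transProj_union (hs a) (hfinU F), ih, Finset.sum_insert ha]
        rw [Set.disjoint_iUnion₂_right]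
        exact fun j hj => hd (fun h => ha (h ▸ hj))
    -- The remainder of the series is the projection of the remaining set, whose norm is controlled
    -- by the measure of that set.
    have hrem : ∀ F : Finset ℕ, ‖(∑ j ∈ F, transProj W (s j) h) - transProj W (⋃ j, s j) h‖ ^ 2 =
        (sqDensity μ (W h) ((⋃ j, s j) \ ⋃ j ∈ F, s j)).toReal := by
      intro F
      have h1 : transProj W (⋃ j, s j) h = transProj W (⋃ j ∈ F, s j) h +
          transProj W ((⋃ j, s j) \ ⋃ j ∈ F, s j) h := by
        rw [← transProj_union (hfinU F) (hU.diff (hfinU F)) Set.disjoint_sdiff_right,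
          Set.union_sdiff_cancel (Set.iUnion₂_subset fun j _ => Set.subset_iUnion s j)]
      rw [h1, hsum, sub_add_cancel_left, norm_neg, ← norm_transProj_sq h (hU.diff (hfinU F)),
        ENNReal.toReal_ofReal (by positivity)]
    have hfin : IsFiniteMeasure (sqDensity μ (W h)) := by
      constructor
      rw [← norm_transProj_sq h MeasurableSet.univ]
      exact ENNReal.ofReal_lt_top
    have htend : Tendsto (fun F : Finset ℕ =>
        (sqDensity μ (W h) ((⋃ j, s j) \ ⋃ j ∈ F, s j)).toReal) atTop (𝓝 0) := by
      have h1 : HasSum (fun j => (sqDensity μ (W h)).real (s j))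
          ((sqDensity μ (W h)).real (⋃ j, s j)) := by
        have hne : ∑' j, sqDensity μ (W h) (s j) ≠ ∞ := by
          rw [← measure_iUnion hd hs]
          exact measure_ne_top _ _
        rw [measureReal_def, measure_iUnion hd hs,
          ENNReal.tsum_toReal_eq fun j => measure_ne_top _ _]
        exact ENNReal.hasSum_toReal hne
      have h2 : ∀ F : Finset ℕ, (sqDensity μ (W h) ((⋃ j, s j) \ ⋃ j ∈ F, s j)).toReal =
          (sqDensity μ (W h)).real (⋃ j, s j) - ∑ j ∈ F, (sqDensity μ (W h)).real (s j) := by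
        intro F
        rw [← measureReal_biUnion_finset (fun i _ j _ hij => hd hij) (fun j _ => hs j)]
        exact measureReal_sdiff (Set.iUnion₂_subset fun j _ => Set.subset_iUnion s j) (hfinU F)
      simp_rw [h2]
      simpa using h1.const_sub ((sqDensity μ (W h)).real (⋃ j, s j))
    rw [HasSum, tendsto_iff_norm_sub_tendsto_zero]
    have h3 := htend.sqrt
    rw [Real.sqrt_zero] at h3
    refine h3.congr fun F => ?_
    rw [← hrem, Real.sqrt_sq (norm_nonneg _)]

theorem scalarMeasure_transSpectral [CompleteSpace H] (h : H) :
    (transSpectral W).scalarMeasure h = sqDensity μ (W h) := by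
  ext s hs
  rw [SpectralMeasure.scalarMeasure_apply _ _ hs]
  exact ofReal_inner_transProj h hs

theorem isIntegral_transSpectral [CompleteSpace H] {T : H →ₗ.[ℂ] H}
    (hT : T.graph = mulGraph W f) (hf : Measurable f) : (transSpectral W).IsIntegral f T := by
  have hf' : Measurable fun p => (f p : ℂ) := by fun_prop
  have hW : ∀ h, Measurable (W h) := fun h => (Lp.stronglyMeasurable _).measurable
  refine ⟨fun h => ?_, fun h => ?_⟩
  · rw [scalarMeasure_transSpectral, memLp_ofReal_iff hf, memLp_sqDensity_iff (hW h) hf']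
    constructor
    · intro hh
      have h1 := T.mem_graph ⟨h, hh⟩
      rw [hT, mem_mulGraph] at h1
      exact (memLp_congr_ae h1).1 (Lp.memLp _)
    · intro hh
      have h1 : (h, W.symm hh.toLp) ∈ T.graph := by
        rw [hT, mem_mulGraph, LinearIsometryEquiv.apply_symm_apply]
        exact hh.coeFn_toLp
      exact LinearPMap.mem_domain_of_mem_graph h1
  · have h1 := T.mem_graph h
    rw [hT, mem_mulGraph] at h1
    rw [scalarMeasure_transSpectral, ← W.inner_map_map, L2.inner_def, ← integral_complex_ofReal,
      sqDensity, integral_withDensity_eq_integral_toReal_smul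
        (by have := hW h; fun_prop) (Eventually.of_forall fun p => by simp)]
    refine integral_congr_ae ?_
    filter_upwards [h1] with p hp
    rw [hp, ENNReal.toReal_pow, toReal_enorm, RCLike.inner_apply, Complex.real_smul]
    have := Complex.mul_conj (W h p)
    rw [Complex.normSq_eq_norm_sq] at this
    rw [← this]
    ring

end Transport

/-! ### The shift operators -/

section Shift

variable {u : Index → ℂ} {μ : Measure (ℝ × ℝ)} {H : Type*} [NormedAddCommGroup H]
  [InnerProductSpace ℂ H] {x : Index → H}

theorem IsSolution.inner_monomial (h : IsSolution u μ) (w w' : Index) :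
    inner ℂ (h.memLp_monomial w').toLp (h.memLp_monomial w).toLp = u (w.pair w') := by
  rw [L2.inner_def, ← (h _).2]
  refine integral_congr_ae ?_
  filter_upwards [(h.memLp_monomial w').coeFn_toLp, (h.memLp_monomial w).coeFn_toLp] with p h1 h2
  rw [h1, h2, monomial_pair, RCLike.inner_apply]

/-- The model space is `L²(μ)`, with the monomials as the family `x`. -/
theorem IsModel.exists_unitary [CompleteSpace H] (hx : IsModel u x) (h : IsSolution u μ) :
    ∃ W : H ≃ₗᵢ[ℂ] Lp ℂ 2 μ, ∀ w, W (x w) = (h.memLp_monomial w).toLp :=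
  exists_linearIsometryEquiv_of_gram (fun i j => by rw [hx.gram, h.inner_monomial])
    hx.dense_span h.dense_monomial

theorem IsSolution.isModel (h : IsSolution u μ) :
    IsModel u fun w => (h.memLp_monomial w).toLp :=
  ⟨h.inner_monomial, h.dense_monomial⟩

variable {W : H ≃ₗᵢ[ℂ] Lp ℂ 2 μ} {f : ℝ × ℝ → ℝ} {σ : Index → Index}

/-- The span of the pairs `(x w, x (σ w))`, the graph of the shift operator. -/
def shiftGraph (x : Index → H) (σ : Index → Index) : Submodule ℂ (H × H) :=
  Submodule.span ℂ (Set.range fun w => (x w, x (σ w)))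

theorem shiftGraph_le (hW : ∀ w, W (x w) =ᵐ[μ] monomial w)
    (hσ : ∀ w p, monomial (σ w) p = f p * monomial w p) : shiftGraph x σ ≤ mulGraph W f := by
  rw [shiftGraph, Submodule.span_le]
  rintro _ ⟨w, rfl⟩
  change (x w, x (σ w)) ∈ mulGraph W f
  rw [mem_mulGraph]
  filter_upwards [hW w, hW (σ w)] with p h1 h2
  rw [h1, h2, hσ]

/-- The shift is essentially multiplication by `f`: the resolvent of the latter at `i` maps the
linear span of the monomials to itself. -/
theorem closure_shiftGraph (hx : (Submodule.span ℂ (Set.range x)).topologicalClosure = ⊤)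
    (hf : Measurable f) (hW : ∀ w, W (x w) =ᵐ[μ] monomial w)
    (hσ : ∀ w p, monomial (σ w) p = f p * monomial w p)
    (hinv : ∀ w, ∃ w', ∀ p, monomial w p = (f p - Complex.I) * monomial w' p) :
    (shiftGraph x σ).topologicalClosure = mulGraph W f := by
  have hI : Complex.I.im ≠ 0 := by simp
  refine le_antisymm (Submodule.topologicalClosure_minimal _ (shiftGraph_le hW hσ)
    (isClosed_mulGraph hf)) ?_
  set R := transMul W _ (memLp_resolvent (μ := μ) hf hI) with hR
  let J : H →L[ℂ] H × H := R.prod (ContinuousLinearMap.id ℂ H + Complex.I • R)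
  have hJ : ∀ y, J y ∈ (shiftGraph x σ).topologicalClosure := by
    have hspan : Submodule.span ℂ (Set.range x) ≤
        ((shiftGraph x σ).topologicalClosure).comap J.toLinearMap := by
      rw [Submodule.span_le]
      rintro _ ⟨w, rfl⟩
      obtain ⟨w', hw'⟩ := hinv w
      have h1 : (x w', x (σ w')) ∈ mulGraph W f := shiftGraph_le hW hσ
        (Submodule.subset_span ⟨w', rfl⟩)
      have h2 : x (σ w') - Complex.I • x w' = x w := by
        refine eq_of_apply_ae (W := W) ?_
        rw [map_sub, map_smul]
        filter_upwards [hW w, hW w', hW (σ w'), Lp.coeFn_sub (W (x (σ w'))) (Complex.I • W (x w')),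
          Lp.coeFn_smul Complex.I (W (x w'))] with p h1 h2 h3 h4 h5
        rw [h4, Pi.sub_apply, h5, Pi.smul_apply, h1, h2, h3, hσ, hw', smul_eq_mul, sub_mul]
      have h3 : R (x w) = x w' := by
        rw [mem_mulGraph_iff_resolvent hf hI, h2] at h1
        exact h1
      refine Submodule.le_topologicalClosure _ (Submodule.subset_span ⟨w', ?_⟩)
      change (x w', x (σ w')) = (R (x w), x w + Complex.I • R (x w))
      rw [h3, ← h2, sub_add_cancel]
    have hcl : IsClosed (((shiftGraph x σ).topologicalClosure.comap J.toLinearMap : Submodule ℂ H)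
        : Set H) :=
      (Submodule.isClosed_topologicalClosure _).preimage J.continuous
    have htop := Submodule.topologicalClosure_minimal _ hspan hcl
    rw [hx] at htop
    exact fun y => htop Submodule.mem_top
  rintro ⟨h, h'⟩ hm
  rw [mem_mulGraph_iff_resolvent hf hI, ← hR] at hm
  have := hJ (h' - Complex.I • h)
  change (R _, (h' - Complex.I • h) + Complex.I • R _) ∈ _ at this
  rwa [hm, sub_add_cancel] at this

theorem graph_shiftOperator (hW : ∀ w, W (x w) =ᵐ[μ] monomial w)
    (hσ : ∀ w p, monomial (σ w) p = f p * monomial w p) :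
    (shiftOperator x σ).graph = shiftGraph x σ :=
  Submodule.toLinearPMap_graph_eq _ fun _ hq h0 => mulGraph_unique (shiftGraph_le hW hσ hq) h0

theorem isWellDefinedShift (hW : ∀ w, W (x w) =ᵐ[μ] monomial w)
    (hσ : ∀ w p, monomial (σ w) p = f p * monomial w p) : IsWellDefinedShift x σ := by
  have hg := graph_shiftOperator hW hσ
  refine ⟨?_, fun α => ?_⟩
  · change (shiftGraph x σ).map (LinearMap.fst ℂ H H) = _
    rw [shiftGraph, Submodule.map_span, ← Set.range_comp]
    rfl
  · have h1 : (∑ w ∈ α.support, α w • x w, ∑ w ∈ α.support, α w • x (σ w)) ∈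
        (shiftOperator x σ).graph := by
      have h2 : (∑ w ∈ α.support, α w • x w, ∑ w ∈ α.support, α w • x (σ w)) =
          ∑ w ∈ α.support, α w • (x w, x (σ w)) := by
        ext <;> simp [Prod.fst_sum, Prod.snd_sum]
      rw [hg, h2]
      exact Submodule.sum_mem _ fun w _ =>
        Submodule.smul_mem _ _ (Submodule.subset_span ⟨w, rfl⟩)
    obtain ⟨h, h2⟩ := (LinearPMap.mem_graph_iff _).1 h1
    simp only at h2
    exact ⟨h2.1 ▸ h.2, (congrArg (shiftOperator x σ) (Subtype.ext h2.1.symm)).trans h2.2⟩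

theorem dense_domain_shiftOperator
    (hx : (Submodule.span ℂ (Set.range x)).topologicalClosure = ⊤)
    (h : IsWellDefinedShift x σ) : Dense ((shiftOperator x σ).domain : Set H) := by
  rw [h.1, Submodule.dense_iff_topologicalClosure_eq_top]
  exact hx

theorem isClosable_shiftOperator (hx : (Submodule.span ℂ (Set.range x)).topologicalClosure = ⊤)
    (hf : Measurable f) (hW : ∀ w, W (x w) =ᵐ[μ] monomial w)
    (hσ : ∀ w p, monomial (σ w) p = f p * monomial w p)
    (hinv : ∀ w, ∃ w', ∀ p, monomial w p = (f p - Complex.I) * monomial w' p) :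
    (shiftOperator x σ).IsClosable := by
  refine ⟨(mulGraph W f).toLinearPMap, ?_⟩
  rw [graph_shiftOperator hW hσ, closure_shiftGraph hx hf hW hσ hinv,
    Submodule.toLinearPMap_graph_eq _ fun _ hq h0 => mulGraph_unique hq h0]

theorem graph_closure_shiftOperator (hx : (Submodule.span ℂ (Set.range x)).topologicalClosure = ⊤)
    (hf : Measurable f) (hW : ∀ w, W (x w) =ᵐ[μ] monomial w)
    (hσ : ∀ w p, monomial (σ w) p = f p * monomial w p)
    (hinv : ∀ w, ∃ w', ∀ p, monomial w p = (f p - Complex.I) * monomial w' p) :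
    (shiftOperator x σ).closure.graph = mulGraph W f := by
  rw [← (isClosable_shiftOperator hx hf hW hσ hinv).graph_closure_eq_closure_graph,
    graph_shiftOperator hW hσ, closure_shiftGraph hx hf hW hσ hinv]

theorem dense_domain_closure_shiftOperator
    (hx : (Submodule.span ℂ (Set.range x)).topologicalClosure = ⊤)
    (h : IsWellDefinedShift x σ) : Dense ((shiftOperator x σ).closure.domain : Set H) :=
  (dense_domain_shiftOperator hx h).mono (LinearPMap.le_closure _).1

theorem isEssentiallySelfAdjoint_shiftOperator [CompleteSpace H]
    (hx : (Submodule.span ℂ (Set.range x)).topologicalClosure = ⊤)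
    (hf : Measurable f) (hW : ∀ w, W (x w) =ᵐ[μ] monomial w)
    (hσ : ∀ w p, monomial (σ w) p = f p * monomial w p)
    (hinv : ∀ w, ∃ w', ∀ p, monomial w p = (f p - Complex.I) * monomial w' p) :
    IsEssentiallySelfAdjoint (shiftOperator x σ) where
  dense_domain := dense_domain_shiftOperator hx (isWellDefinedShift hW hσ)
  closable := isClosable_shiftOperator hx hf hW hσ hinv
  selfAdjoint := isSelfAdjoint_of_graph
    (dense_domain_closure_shiftOperator hx (isWellDefinedShift hW hσ))
    (graph_closure_shiftOperator hx hf hW hσ hinv) hf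

theorem exists_monomial_eq_fst (w : Index) :
    ∃ w' : Index, ∀ p, monomial w p = ((p.1 : ℂ) - Complex.I) * monomial w' p := by
  refine ⟨{ w with l := w.l - 1 }, fun p => ?_⟩
  rw [← monomial_succL]
  simp [Index.succL]

theorem exists_monomial_eq_snd (w : Index) :
    ∃ w' : Index, ∀ p, monomial w p = ((p.2 : ℂ) - Complex.I) * monomial w' p := by
  refine ⟨{ w with t := w.t - 1 }, fun p => ?_⟩
  rw [← monomial_succT]
  simp [Index.succT]

theorem stronglyCommute_of_graph {f g : ℝ × ℝ → ℝ} (hf : Measurable f) (hg : Measurable g)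
    {S T : H →ₗ.[ℂ] H} (hS : S.graph = mulGraph W f) (hT : T.graph = mulGraph W g) :
    StronglyCommute S T := fun _ _ hz hz' =>
  ⟨_, _, isResolventAt_of_graph hS hf hz, isResolventAt_of_graph hT hg hz', transMul_commute _ _⟩

end Shift

/-! ### Integration with respect to a spectral measure -/

theorem span_indicatorConstLp_closure_eq_top {X : Type*} [MeasurableSpace X] (ν : Measure X)
    [IsFiniteMeasure ν] :
    (Submodule.span ℂ (Set.range fun s : {s : Set X // MeasurableSet s} =>
      indicatorConstLp 2 s.2 (measure_ne_top ν s.1) (1 : ℂ))).topologicalClosure = ⊤ := by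
  rw [eq_top_iff]
  rintro g -
  refine Lp.induction (p := 2) (by simp) (fun g => g ∈ Submodule.topologicalClosure _)
    (fun c {s} hs hfin => ?_) (fun f g hf hg _ h1 h2 => ?_) ?_ g
  · rw [Lp.simpleFunc.coe_indicatorConst]
    have h1 : indicatorConstLp 2 hs hfin.ne c =
        c • indicatorConstLp 2 hs (measure_ne_top ν s) (1 : ℂ) := by
      refine Lp.ext ?_
      filter_upwards [indicatorConstLp_coeFn (hs := hs) (hμs := hfin.ne) (c := c) (p := 2),
        indicatorConstLp_coeFn (hs := hs) (hμs := measure_ne_top ν s) (c := (1 : ℂ)) (p := 2),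
        Lp.coeFn_smul c (indicatorConstLp 2 hs (measure_ne_top ν s) (1 : ℂ))] with p h1 h2 h3
      rw [h1, h3, Pi.smul_apply, h2]
      by_cases hp : p ∈ s <;> simp [hp]
    rw [h1]
    exact Submodule.smul_mem _ _ (Submodule.le_topologicalClosure _
      (Submodule.subset_span ⟨⟨s, hs⟩, rfl⟩))
  · exact Submodule.add_mem _ h1 h2
  · exact Submodule.isClosed_topologicalClosure _

namespace SpectralMeasure

variable {X : Type*} [MeasurableSpace X] {H : Type*} [NormedAddCommGroup H]
  [InnerProductSpace ℂ H] [CompleteSpace H] (E : SpectralMeasure X H)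

instance isFiniteMeasure_scalarMeasure (h : H) : IsFiniteMeasure (E.scalarMeasure h) := by
  constructor
  rw [E.scalarMeasure_apply h MeasurableSet.univ]
  exact ENNReal.ofReal_lt_top

theorem inner_proj_proj {s t : Set X} (hs : MeasurableSet s) (ht : MeasurableSet t) (h : H) :
    inner ℂ (E.proj s h) (E.proj t h) = (((E.scalarMeasure h).real (s ∩ t) : ℝ) : ℂ) := by
  have hsym : inner ℂ (E.proj s h) (E.proj t h) = inner ℂ h (E.proj s (E.proj t h)) :=
    ContinuousLinearMap.isSelfAdjoint_iff_isSymmetric.1 (E.isStarProjection s hs).isSelfAdjoint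
      h (E.proj t h)
  rw [hsym, ← mul_apply_eq_comp, ← E.inter s t hs ht, measureReal_def,
    E.scalarMeasure_apply h (hs.inter ht), E.inner_proj (hs.inter ht), Complex.ofReal_re,
    ENNReal.toReal_ofReal (by positivity)]

theorem exists_integralVec (h : H) : ∃ V : Lp ℂ 2 (E.scalarMeasure h) →ₗᵢ[ℂ] H,
    ∀ s : {s : Set X // MeasurableSet s},
      V (indicatorConstLp 2 s.2 (measure_ne_top _ s.1) (1 : ℂ)) = E.proj s.1 h := by
  refine exists_linearIsometry_of_gram (fun s t => ?_) (span_indicatorConstLp_closure_eq_top _)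
  rw [E.inner_proj_proj s.2 t.2, L2.inner_indicatorConstLp_indicatorConstLp]
  simp

/-- The isometry `φ ↦ ∫ φ dE h` of `L²(E h, h)` into `H`, which is determined by its values
`E(s) h` on the indicator functions. -/
noncomputable def integralVec (h : H) : Lp ℂ 2 (E.scalarMeasure h) →ₗᵢ[ℂ] H :=
  (E.exists_integralVec h).choose

theorem integralVec_indicator (h : H) {s : Set X} (hs : MeasurableSet s) :
    E.integralVec h (indicatorConstLp 2 hs (measure_ne_top _ s) (1 : ℂ)) = E.proj s h :=
  (E.exists_integralVec h).choose_spec ⟨s, hs⟩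

theorem integralVec_one (h : H) :
    E.integralVec h (memLp_const (1 : ℂ)).toLp = h := by
  have h1 := E.integralVec_indicator h MeasurableSet.univ
  rw [E.univ] at h1
  have h2 : (memLp_const (μ := E.scalarMeasure h) (p := 2) (1 : ℂ)).toLp =
      indicatorConstLp 2 MeasurableSet.univ (measure_ne_top (E.scalarMeasure h) Set.univ)
        (1 : ℂ) := by
    refine Lp.ext ?_
    filter_upwards [indicatorConstLp_coeFn (μ := E.scalarMeasure h) (hs := MeasurableSet.univ)
      (hμs := measure_ne_top _ _) (c := (1 : ℂ)) (p := 2),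
      (memLp_const (μ := E.scalarMeasure h) (p := 2) (1 : ℂ)).coeFn_toLp] with p h1 h2
    rw [h1, h2]
    simp
  rw [h2, h1]
  rfl

theorem proj_integralVec (h : H) {s : Set X} (hs : MeasurableSet s)
    (g : Lp ℂ 2 (E.scalarMeasure h)) :
    E.proj s (E.integralVec h g) = E.integralVec h (mulOp _ (memLp_top_indicator hs) g) := by
  let A : Lp ℂ 2 (E.scalarMeasure h) →L[ℂ] H :=
    E.proj s ∘L (E.integralVec h).toContinuousLinearMap
  let B : Lp ℂ 2 (E.scalarMeasure h) →L[ℂ] H :=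
    (E.integralVec h).toContinuousLinearMap ∘L mulOp _ (memLp_top_indicator hs)
  have hd : Dense ((Submodule.span ℂ (Set.range fun s : {s : Set X // MeasurableSet s} =>
      indicatorConstLp 2 s.2 (measure_ne_top (E.scalarMeasure h) s.1) (1 : ℂ)) :
        Submodule ℂ (Lp ℂ 2 (E.scalarMeasure h))) : Set (Lp ℂ 2 (E.scalarMeasure h))) := by
    rw [Submodule.dense_iff_topologicalClosure_eq_top]
    exact span_indicatorConstLp_closure_eq_top _
  have hAB : A = B := by
    refine ContinuousLinearMap.ext_on hd ?_
    rintro _ ⟨⟨t, ht⟩, rfl⟩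
    change E.proj s (E.integralVec h _) = E.integralVec h (mulOp _ (memLp_top_indicator hs)
      (indicatorConstLp 2 ht (measure_ne_top (E.scalarMeasure h) t) (1 : ℂ)))
    rw [E.integralVec_indicator h ht, ← mul_apply_eq_comp, ← E.inter s t hs ht,
      ← E.integralVec_indicator h (hs.inter ht)]
    congr 1
    refine Lp.ext ?_
    filter_upwards [mulOp_coeFn (memLp_top_indicator hs)
        (indicatorConstLp 2 ht (measure_ne_top (E.scalarMeasure h) t) (1 : ℂ)),
      indicatorConstLp_coeFn (μ := E.scalarMeasure h) (hs := ht) (hμs := measure_ne_top _ _)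
        (c := (1 : ℂ)) (p := 2),
      indicatorConstLp_coeFn (μ := E.scalarMeasure h) (hs := hs.inter ht)
        (hμs := measure_ne_top _ _) (c := (1 : ℂ)) (p := 2)] with p h1 h2 h3
    rw [h1, h2, h3]
    by_cases hps : p ∈ s <;> by_cases hpt : p ∈ t <;> simp [hps, hpt]
  exact congrArg (fun C : _ →L[ℂ] H => C g) hAB

theorem scalarMeasure_integralVec (h : H) (g : Lp ℂ 2 (E.scalarMeasure h)) :
    E.scalarMeasure (E.integralVec h g) = sqDensity (E.scalarMeasure h) g := by
  ext s hs
  rw [E.scalarMeasure_apply _ hs, E.proj_integralVec h hs, LinearIsometry.inner_map_map,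
    ofReal_inner_mulOp_indicator g hs]

/-- The integral of a simple function with respect to the spectral measure. -/
noncomputable def simpleIntegral (φ : SimpleFunc X ℂ) : H →L[ℂ] H :=
  ∑ c ∈ φ.range, c • E.proj (φ ⁻¹' {c})

theorem simpleIntegral_integralVec (φ : SimpleFunc X ℂ) (h : H) (g : Lp ℂ 2 (E.scalarMeasure h))
    (hm : MemLp (fun p => φ p * g p) 2 (E.scalarMeasure h)) :
    E.simpleIntegral φ (E.integralVec h g) = E.integralVec h hm.toLp := by
  have h0 : E.simpleIntegral φ (E.integralVec h g) = E.integralVec h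
      (∑ c ∈ φ.range, c • mulOp _ (memLp_top_indicator (φ.measurableSet_preimage {c})) g) := by
    rw [map_sum, simpleIntegral, sum_apply]
    refine Finset.sum_congr rfl fun c _ => ?_
    rw [smul_apply, E.proj_integralVec h (φ.measurableSet_preimage _), map_smul]
  rw [h0]
  congr 1
  refine Lp.ext ?_
  have h1 : ∀ᵐ p ∂(E.scalarMeasure h), ∀ c ∈ φ.range,
      (c • mulOp _ (memLp_top_indicator (φ.measurableSet_preimage {c})) g) p =
        c * ((φ ⁻¹' {c}).indicator (fun _ => (1 : ℂ)) p * g p) := by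
    rw [Finset.eventually_all]
    intro c _
    filter_upwards [Lp.coeFn_smul c
        (mulOp _ (memLp_top_indicator (φ.measurableSet_preimage {c})) g),
      mulOp_coeFn (memLp_top_indicator (φ.measurableSet_preimage {c})) g] with p h1 h2
    rw [h1, Pi.smul_apply, h2, smul_eq_mul]
  filter_upwards [h1, hm.coeFn_toLp, Lp.coeFn_finsetSum φ.range
    fun c => c • mulOp _ (memLp_top_indicator (φ.measurableSet_preimage {c})) g] with p h2 h3 h4
  rw [h4, h3, Finset.sum_apply, Finset.sum_congr rfl h2,
    Finset.sum_eq_single_of_mem (φ p) (φ.mem_range_self p)]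
  · simp
  · intro c _ hc
    have : p ∉ φ ⁻¹' {c} := fun hp => hc (by simpa using Eq.symm hp)
    simp [this]

/-- Approximation of the integral by integrals of simple functions which do not depend on the
vectors. -/
theorem tendsto_simpleIntegral {φ : X → ℂ} (hφ : Measurable φ) (h : H)
    (g : Lp ℂ 2 (E.scalarMeasure h)) (hm : MemLp (fun p => φ p * g p) 2 (E.scalarMeasure h)) :
    Tendsto (fun n => E.simpleIntegral (SimpleFunc.approxOn φ hφ (Set.range φ ∪ {0}) 0 (by simp) n)
      (E.integralVec h g)) atTop (𝓝 (E.integralVec h hm.toLp)) := by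
  set ψ : ℕ → SimpleFunc X ℂ :=
    fun n => SimpleFunc.approxOn φ hφ (Set.range φ ∪ {0}) 0 (by simp) n
  have hg : Measurable g := (Lp.stronglyMeasurable g).measurable
  have hm' : MemLp φ 2 (sqDensity (E.scalarMeasure h) g) := (memLp_sqDensity_iff hg hφ).2 hm
  have hψ : ∀ n, MemLp (ψ n) 2 (sqDensity (E.scalarMeasure h) g) := fun n =>
    SimpleFunc.memLp_approxOn_range hφ hm' n
  have hψ' : ∀ n, MemLp (fun p => ψ n p * g p) 2 (E.scalarMeasure h) := fun n =>
    (memLp_sqDensity_iff hg (ψ n).measurable).1 (hψ n)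
  refine Tendsto.congr (fun n => (E.simpleIntegral_integralVec (ψ n) h g (hψ' n)).symm) ?_
  refine ((E.integralVec h).continuous.tendsto _).comp ?_
  rw [Lp.tendsto_Lp_iff_tendsto_eLpNorm'']
  refine (SimpleFunc.tendsto_approxOn_range_Lp_eLpNorm (p := 2) (by simp) hφ hm'.2).congr
    fun n => ?_
  have := eLpNorm_sqDensity (μ := E.scalarMeasure h) hg ((ψ n).measurable.sub hφ)
  rw [this]
  refine congrArg (fun F => eLpNorm F 2 _) (funext fun p => ?_)
  simp only [Pi.sub_apply, sub_mul]

theorem tendsto_simpleIntegral_self {φ : X → ℂ} (hφ : Measurable φ) {h : H}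
    (hm : MemLp φ 2 (E.scalarMeasure h)) :
    Tendsto (fun n => E.simpleIntegral (SimpleFunc.approxOn φ hφ (Set.range φ ∪ {0}) 0 (by simp) n)
      h) atTop (𝓝 (E.integralVec h hm.toLp)) := by
  have h1 : (fun p => φ p * ((memLp_const (μ := E.scalarMeasure h) (p := 2) (1 : ℂ)).toLp) p)
      =ᵐ[E.scalarMeasure h] φ := by
    filter_upwards [(memLp_const (μ := E.scalarMeasure h) (p := 2) (1 : ℂ)).coeFn_toLp] with p hp
    rw [hp, mul_one]
  have h2 := E.tendsto_simpleIntegral hφ h _ ((memLp_congr_ae h1).2 hm)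
  rw [E.integralVec_one, (MemLp.toLp_eq_toLp_iff _ hm).2 h1] at h2
  exact h2

/-- The chain rule for integrals: if `k = ∫ g dE h`, then `∫ φ dE k = ∫ φ g dE h`. -/
theorem integralVec_integralVec {φ : X → ℂ} (hφ : Measurable φ) {h k : H}
    {g : Lp ℂ 2 (E.scalarMeasure h)} (hk : E.integralVec h g = k)
    (hm : MemLp φ 2 (E.scalarMeasure k))
    (hm' : MemLp (fun p => φ p * g p) 2 (E.scalarMeasure h)) :
    E.integralVec k hm.toLp = E.integralVec h hm'.toLp := by
  have h1 := E.tendsto_simpleIntegral_self hφ hm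
  have h2 := E.tendsto_simpleIntegral hφ h g hm'
  rw [hk] at h2
  exact tendsto_nhds_unique h1 h2

theorem memLp_of_integralVec {φ : X → ℂ} (hφ : Measurable φ) {h k : H}
    {g : Lp ℂ 2 (E.scalarMeasure h)} (hk : E.integralVec h g = k) :
    MemLp φ 2 (E.scalarMeasure k) ↔ MemLp (fun p => φ p * g p) 2 (E.scalarMeasure h) := by
  rw [← hk, E.scalarMeasure_integralVec, memLp_sqDensity_iff
    (Lp.stronglyMeasurable g).measurable hφ]

theorem inner_integralVec {φ : X → ℂ} {h : H} (hm : MemLp φ 2 (E.scalarMeasure h)) :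
    inner ℂ h (E.integralVec h hm.toLp) = ∫ p, φ p ∂(E.scalarMeasure h) := by
  have h1 : inner ℂ h (E.integralVec h hm.toLp) = inner ℂ
      (memLp_const (μ := E.scalarMeasure h) (p := 2) (1 : ℂ)).toLp hm.toLp := by
    rw [← LinearIsometry.inner_map_map (E.integralVec h), E.integralVec_one]
  rw [h1, L2.inner_def]
  refine integral_congr_ae ?_
  filter_upwards [(memLp_const (μ := E.scalarMeasure h) (p := 2) (1 : ℂ)).coeFn_toLp,
    hm.coeFn_toLp] with p h1 h2
  rw [h1, h2]
  simp

variable {E}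

/-- The quadratic form determines the operator: if `T = ∫ f dE` in the sense of quadratic forms,
then `T h = ∫ f dE h`. -/
theorem IsIntegral.apply_eq {f : X → ℝ} (hf : Measurable f) {T : H →ₗ.[ℂ] H}
    (hT : E.IsIntegral f T) (hd : Dense (T.domain : Set H)) (h : T.domain)
    (hm : MemLp (fun p => (f p : ℂ)) 2 (E.scalarMeasure (h : H))) :
    T h = E.integralVec (h : H) hm.toLp := by
  have hf' : Measurable fun p => (f p : ℂ) := by fun_prop
  have hdom : ∀ k : T.domain, MemLp (fun p => (f p : ℂ)) 2 (E.scalarMeasure (k : H)) := fun k =>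
    (memLp_ofReal_iff hf).1 ((hT.1 k).1 k.2)
  have hlim := fun k : T.domain => E.tendsto_simpleIntegral_self hf' (hdom k)
  let N : T.domain →ₗ[ℂ] H :=
    { toFun := fun k => T k - E.integralVec (k : H) (hdom k).toLp
      map_add' := fun k k' => by
        have h1 := hlim (k + k')
        have h2 := (hlim k).add (hlim k')
        simp only [Submodule.coe_add, map_add] at h1
        have h3 : E.integralVec ((k + k' : T.domain) : H) (hdom (k + k')).toLp =
            E.integralVec (k : H) (hdom k).toLp + E.integralVec (k' : H) (hdom k').toLp :=
          tendsto_nhds_unique h1 h2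
        rw [LinearPMap.map_add, h3]
        abel
      map_smul' := fun c k => by
        have h1 := hlim (c • k)
        have h2 := (hlim k).const_smul c
        simp only [Submodule.coe_smul, map_smul] at h1
        have h3 : E.integralVec ((c • k : T.domain) : H) (hdom (c • k)).toLp =
            c • E.integralVec (k : H) (hdom k).toLp := tendsto_nhds_unique h1 h2
        rw [LinearPMap.map_smul, h3, RingHom.id_apply, smul_sub] }
  have hN : ∀ k : T.domain, inner ℂ (k : H) (N k) = 0 := by
    intro k
    change inner ℂ (k : H) (T k - E.integralVec (k : H) (hdom k).toLp) = 0
    rw [inner_sub_right, hT.2 k, E.inner_integralVec, integral_complex_ofReal, sub_self]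
  have hpol : ∀ k k' : T.domain, inner ℂ (k : H) (N k') = 0 := by
    intro k k'
    have h1 := hN (k + k')
    have h2 := hN (k + Complex.I • k')
    simp only [map_add, map_smul, Submodule.coe_add, Submodule.coe_smul, inner_add_left,
      inner_add_right, inner_smul_left, inner_smul_right, hN, Complex.conj_I] at h1 h2
    have hI := Complex.I_mul_I
    linear_combination (1 / 2 : ℂ) * h1 - (Complex.I / 2) * h2 +
      ((inner ℂ (k : H) (N k') : ℂ) / 2 - (inner ℂ (k' : H) (N k) : ℂ) / 2) * hI
  have h0 : N h = 0 := hd.eq_zero_of_inner_right (𝕜 := ℂ) fun k hk => hpol ⟨k, hk⟩ h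
  exact sub_eq_zero.1 h0

/-- An operator which is the integral of a real function has no non-real eigenvalues. -/
theorem IsIntegral.eq_of_sub_eq {f : X → ℝ} {T : H →ₗ.[ℂ] H} (hT : E.IsIntegral f T) {z : ℂ}
    (hz : z.im ≠ 0) {h k : T.domain} (hhk : T h - z • (h : H) = T k - z • (k : H)) :
    (h : H) = k := by
  have h1 : T (h - k) = z • ((h - k : T.domain) : H) := by
    rw [LinearPMap.map_sub, Submodule.coe_sub, smul_sub]
    exact sub_eq_sub_iff_sub_eq_sub.1 hhk
  have h2 := hT.2 (h - k)
  rw [h1, inner_smul_right, inner_self_eq_norm_sq_to_K] at h2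
  have h3 := congrArg Complex.im h2
  have h4 : z.im * ‖((h - k : T.domain) : H)‖ ^ 2 = 0 := by
    rw [Complex.ofReal_im] at h3
    have h6 := Complex.im_mul_ofReal z (‖((h - k : T.domain) : H)‖ ^ 2)
    rw [Complex.ofReal_pow] at h6
    exact h6.symm.trans h3
  have h5 : ((h - k : T.domain) : H) = 0 := by simpa [hz] using h4
  exact sub_eq_zero.1 h5

end SpectralMeasure

/-! ### Joint spectral measures represent the moments -/

section Joint

variable {X : Type*} [MeasurableSpace X] {H : Type*} [NormedAddCommGroup H]
  [InnerProductSpace ℂ H] [CompleteSpace H] {E : SpectralMeasure X H}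

/-- The vector `k` is `∫ φ dE h`. -/
def SpectralMeasure.Represents (E : SpectralMeasure X H) (h : H) (φ : X → ℂ) (k : H) : Prop :=
  ∃ hm : MemLp φ 2 (E.scalarMeasure h), E.integralVec h hm.toLp = k

namespace SpectralMeasure

theorem Represents.add_smul {h k k' : H} {φ φ' : X → ℂ} (hk : E.Represents h φ k)
    (hk' : E.Represents h φ' k') (c : ℂ) :
    E.Represents h (fun p => φ p + c * φ' p) (k + c • k') := by
  obtain ⟨hm, rfl⟩ := hk
  obtain ⟨hm', rfl⟩ := hk'
  refine ⟨hm.add (hm'.const_mul c), ?_⟩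
  rw [← map_smul, ← map_add, ← MemLp.toLp_const_smul, ← MemLp.toLp_add]
  rfl

theorem Represents.inner_eq {h k : H} {φ : X → ℂ} (hk : E.Represents h φ k) :
    Integrable φ (E.scalarMeasure h) ∧ ∫ p, φ p ∂(E.scalarMeasure h) = inner ℂ h k := by
  obtain ⟨hm, rfl⟩ := hk
  exact ⟨hm.integrable (by norm_num), (E.inner_integralVec hm).symm⟩

variable {f : X → ℝ} {T : H →ₗ.[ℂ] H}

theorem Represents.memLp_iff {h k : H} {φ : X → ℂ} (hf : Measurable f) (hk : E.Represents h φ k) :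
    MemLp (fun p => (f p : ℂ)) 2 (E.scalarMeasure k) ↔
      MemLp (fun p => (f p : ℂ) * φ p) 2 (E.scalarMeasure h) := by
  obtain ⟨hm, hk⟩ := hk
  have hf' : Measurable fun p => (f p : ℂ) := by fun_prop
  rw [E.memLp_of_integralVec hf' hk]
  refine memLp_congr_ae ?_
  filter_upwards [hm.coeFn_toLp] with p hp
  rw [hp]

/-- The operator `∫ f dE` acts as multiplication by `f`. -/
theorem Represents.apply {h : H} {φ : X → ℂ} {k : T.domain} (hf : Measurable f)
    (hT : E.IsIntegral f T) (hd : Dense (T.domain : Set H)) (hk : E.Represents h φ k) :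
    E.Represents h (fun p => (f p : ℂ) * φ p) (T k) := by
  have hf' : Measurable fun p => (f p : ℂ) := by fun_prop
  have h1 := (memLp_ofReal_iff hf).1 ((hT.1 k).1 k.2)
  have h2 := (hk.memLp_iff hf).1 h1
  refine ⟨h2, ?_⟩
  obtain ⟨hm, hk⟩ := hk
  have h3 := (E.memLp_of_integralVec hf' hk).1 h1
  rw [hT.apply_eq hf hd k h1, E.integralVec_integralVec hf' hk h1 h3]
  congr 1
  rw [MemLp.toLp_eq_toLp_iff]
  filter_upwards [hm.coeFn_toLp] with p hp
  rw [hp]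

/-- The resolvent of `∫ f dE` acts as division by `f - z`. -/
theorem Represents.of_resolvent {h : H} {φ ψ : X → ℂ} {k : T.domain} {z : ℂ} (hz : z.im ≠ 0)
    (hf : Measurable f) (hψ : Measurable ψ) (hT : E.IsIntegral f T)
    (hd : Dense (T.domain : Set H))
    (hφ : ∀ p, φ p = (f p - z) * ψ p) (hk : E.Represents h φ (T k - z • (k : H))) :
    E.Represents h ψ k := by
  have hψ2 : MemLp ψ 2 (E.scalarMeasure h) := by
    refine hk.1.of_le_mul (c := |z.im|⁻¹) hψ.aestronglyMeasurable (Eventually.of_forall fun p => ?_)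
    have h1 : |z.im| ≤ ‖(f p : ℂ) - z‖ := by
      simpa using Complex.abs_im_le_norm ((f p : ℂ) - z)
    rw [hφ, norm_mul, ← div_eq_inv_mul, le_div_iff₀ (abs_pos.2 hz), mul_comm]
    exact mul_le_mul_of_nonneg_right h1 (norm_nonneg _)
  have hr : E.Represents h ψ (E.integralVec h hψ2.toLp) := ⟨hψ2, rfl⟩
  have hfψ : MemLp (fun p => (f p : ℂ) * ψ p) 2 (E.scalarMeasure h) := by
    refine (memLp_congr_ae (Eventually.of_forall fun p => ?_)).1 (hk.1.add (hψ2.const_mul z))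
    simp only [Pi.add_apply, hφ]
    ring
  have hdom : E.integralVec h hψ2.toLp ∈ T.domain :=
    (hT.1 _).2 ((memLp_ofReal_iff hf).2 ((hr.memLp_iff hf).2 hfψ))
  have hr' : E.Represents h ψ ((⟨_, hdom⟩ : T.domain) : H) := hr
  have h1 := (hr'.apply hf hT hd).add_smul hr' (-z)
  obtain ⟨hm, h2⟩ := hk
  obtain ⟨hm', h3⟩ := h1
  have h4 : hm.toLp = hm'.toLp := by
    rw [MemLp.toLp_eq_toLp_iff]
    refine Eventually.of_forall fun p => ?_
    rw [hφ]
    ring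
  rw [h4, h3, neg_smul, ← sub_eq_add_neg] at h2
  have h5 := hT.eq_of_sub_eq hz h2
  rw [← h5]
  exact hr

end SpectralMeasure

end Joint

section Model

variable {u : Index → ℂ} {H : Type*} [NormedAddCommGroup H] [InnerProductSpace ℂ H]
  {x : Index → H}

theorem IsModel.eq_of_gram (hx : IsModel u x) {h k : H}
    (hk : ∀ w, inner ℂ (x w) h = inner ℂ (x w) k) : h = k := by
  have hd := (Submodule.dense_iff_topologicalClosure_eq_top).2 hx.dense_span
  refine hd.eq_of_inner_right (𝕜 := ℂ) fun v hv => ?_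
  induction hv using Submodule.span_induction with
  | mem v hv =>
    obtain ⟨w, rfl⟩ := hv
    exact hk w
  | zero => simp
  | add v v' _ _ h1 h2 => rw [inner_add_left, inner_add_left, h1, h2]
  | smul c v _ h1 => rw [inner_smul_left, inner_smul_left, h1]

theorem IsModel.succK_eq (hx : IsModel u x) (hl : LinearRelations u) (w : Index) :
    x w.succK = x w.succM + Complex.I • x w :=
  hx.eq_of_gram fun w' => by
    rw [inner_add_right, inner_smul_right, hx.gram, hx.gram, hx.gram, hl.rel_k]

theorem IsModel.succL_eq (hx : IsModel u x) (hl : LinearRelations u) (w : Index) :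
    x w.succL = x w.succM - Complex.I • x w :=
  hx.eq_of_gram fun w' => by
    rw [inner_sub_right, inner_smul_right, hx.gram, hx.gram, hx.gram, hl.rel_l]

theorem IsModel.succR_eq (hx : IsModel u x) (hl : LinearRelations u) (w : Index) :
    x w.succR = x w.succN + Complex.I • x w :=
  hx.eq_of_gram fun w' => by
    rw [inner_add_right, inner_smul_right, hx.gram, hx.gram, hx.gram, hl.rel_r]

theorem IsModel.succT_eq (hx : IsModel u x) (hl : LinearRelations u) (w : Index) :
    x w.succT = x w.succN - Complex.I • x w :=
  hx.eq_of_gram fun w' => by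
    rw [inner_sub_right, inner_smul_right, hx.gram, hx.gram, hx.gram, hl.rel_t]

theorem IsWellDefinedShift.closure_apply {σ : Index → Index} (h : IsWellDefinedShift x σ)
    (w : Index) : ∃ k : (shiftOperator x σ).closure.domain,
      (k : H) = x w ∧ (shiftOperator x σ).closure k = x (σ w) := by
  classical
  obtain ⟨h1, h2⟩ := h.2 (Finsupp.single w 1)
  have hs : (Finsupp.single w (1 : ℂ)).support = {w} := by simp
  have h3 : ((∑ v ∈ (Finsupp.single w (1 : ℂ)).support, Finsupp.single w (1 : ℂ) v • x v),
      (∑ v ∈ (Finsupp.single w (1 : ℂ)).support, Finsupp.single w (1 : ℂ) v • x (σ v))) ∈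
      (shiftOperator x σ).graph := by
    rw [LinearPMap.mem_graph_iff]
    exact ⟨⟨_, h1⟩, rfl, h2⟩
  have h4 := LinearPMap.le_graph_of_le (LinearPMap.le_closure (shiftOperator x σ)) h3
  simp only [hs, Finset.sum_singleton, Finsupp.single_eq_same, one_smul] at h4
  exact (LinearPMap.mem_graph_iff _).1 h4

/-- Starting from the index zero, all indices are reached by the six shifts and the inverses of the
four shifts of integer components. -/
theorem Index.induction {P : Index → Prop} (zero : P Index.zero)
    (succM : ∀ w, P w → P w.succM) (succN : ∀ w, P w → P w.succN)
    (succK : ∀ w, P w ↔ P w.succK) (succL : ∀ w, P w ↔ P w.succL)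
    (succR : ∀ w, P w ↔ P w.succR) (succT : ∀ w, P w ↔ P w.succT) (w : Index) : P w := by
  have hZ : ∀ Q : ℤ → Prop, (∀ j, Q j ↔ Q (j + 1)) → Q 0 → ∀ j, Q j := by
    intro Q hQ h0 j
    induction j using Int.induction_on with
    | zero => exact h0
    | succ i ih => exact (hQ _).1 ih
    | pred i ih => exact (hQ _).2 (by rwa [sub_add_cancel])
  obtain ⟨m, k, l, n, r, t⟩ := w
  refine hZ (fun k => P ⟨m, k, l, n, r, t⟩) (fun j => succK _) ?_ k
  refine hZ (fun l => P ⟨m, 0, l, n, r, t⟩) (fun j => succL _) ?_ l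
  refine hZ (fun r => P ⟨m, 0, 0, n, r, t⟩) (fun j => succR _) ?_ r
  refine hZ (fun t => P ⟨m, 0, 0, n, 0, t⟩) (fun j => succT _) ?_ t
  induction m with
  | zero =>
    induction n with
    | zero => exact zero
    | succ n ih => exact succN _ ih
  | succ m ih => exact succM _ ih

variable [CompleteSpace H]

/-- Every joint spectral measure of the closed shift operators solves the moment problem: by
induction on the index, `x w` is the integral of the monomial with index `w`. -/
theorem isSolution_of_isJoint (hx : IsModel u x) (hl : LinearRelations u)
    (hM : IsWellDefinedShift x Index.succM) (hN : IsWellDefinedShift x Index.succN)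
    {E : SpectralMeasure (ℝ × ℝ) H}
    (hE : E.IsJoint (shiftOperator x Index.succM).closure (shiftOperator x Index.succN).closure) :
    IsSolution u (E.scalarMeasure (x Index.zero)) := by
  have hI : Complex.I.im ≠ 0 := by simp
  have hI' : (-Complex.I).im ≠ 0 := by simp
  have hdM := dense_domain_closure_shiftOperator hx.dense_span hM
  have hdN := dense_domain_closure_shiftOperator hx.dense_span hN
  set h₀ := x Index.zero
  let P : Index → Prop := fun w => E.Represents h₀ (monomial w) (x w)
  have hcongr : ∀ {φ ψ : ℝ × ℝ → ℂ} {k k' : H}, E.Represents h₀ φ k → (∀ p, ψ p = φ p) → k' = k →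
      E.Represents h₀ ψ k' := by
    intro φ ψ k k' h1 h2 h3
    rw [funext h2, h3]
    exact h1
  have sM : ∀ w, P w → P w.succM := by
    intro w hw
    obtain ⟨k, hk, hk'⟩ := hM.closure_apply w
    have hw' : E.Represents h₀ (monomial w) k := hcongr hw (fun _ => rfl) hk
    exact hcongr (hw'.apply measurable_fst hE.1 hdM) (monomial_succM w) hk'.symm
  have sN : ∀ w, P w → P w.succN := by
    intro w hw
    obtain ⟨k, hk, hk'⟩ := hN.closure_apply w
    have hw' : E.Represents h₀ (monomial w) k := hcongr hw (fun _ => rfl) hk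
    exact hcongr (hw'.apply measurable_snd hE.2 hdN) (monomial_succN w) hk'.symm
  have main : ∀ w, P w := by
    refine Index.induction ?_ sM sN (fun w => ⟨fun hw => ?_, fun hw => ?_⟩)
      (fun w => ⟨fun hw => ?_, fun hw => ?_⟩) (fun w => ⟨fun hw => ?_, fun hw => ?_⟩)
      (fun w => ⟨fun hw => ?_, fun hw => ?_⟩)
    · exact hcongr ⟨memLp_const (1 : ℂ), E.integralVec_one h₀⟩ monomial_zero rfl
    · refine hcongr ((sM w hw).add_smul hw Complex.I) (fun p => ?_) (hx.succK_eq hl w)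
      rw [monomial_succK, monomial_succM, add_mul]
    · obtain ⟨k, hk, hk'⟩ := hM.closure_apply w
      refine hcongr (SpectralMeasure.Represents.of_resolvent (k := k) hI' measurable_fst
        (measurable_monomial w) hE.1 hdM (φ := monomial w.succK) (fun p => ?_)
        (hcongr hw (fun _ => rfl) ?_)) (fun _ => rfl) hk.symm
      · rw [monomial_succK, sub_neg_eq_add]
      · rw [hk', hk, hx.succK_eq hl, neg_smul, sub_neg_eq_add]
    · refine hcongr ((sM w hw).add_smul hw (-Complex.I)) (fun p => ?_) ?_
      · rw [monomial_succL, monomial_succM]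
        ring
      · rw [hx.succL_eq hl, neg_smul, sub_eq_add_neg]
    · obtain ⟨k, hk, hk'⟩ := hM.closure_apply w
      refine hcongr (SpectralMeasure.Represents.of_resolvent (k := k) hI measurable_fst
        (measurable_monomial w) hE.1 hdM (φ := monomial w.succL) (monomial_succL w)
        (hcongr hw (fun _ => rfl) ?_)) (fun _ => rfl) hk.symm
      rw [hk', hk, hx.succL_eq hl]
    · refine hcongr ((sN w hw).add_smul hw Complex.I) (fun p => ?_) (hx.succR_eq hl w)
      rw [monomial_succR, monomial_succN, add_mul]
    · obtain ⟨k, hk, hk'⟩ := hN.closure_apply w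
      refine hcongr (SpectralMeasure.Represents.of_resolvent (k := k) hI' measurable_snd
        (measurable_monomial w) hE.2 hdN (φ := monomial w.succR) (fun p => ?_)
        (hcongr hw (fun _ => rfl) ?_)) (fun _ => rfl) hk.symm
      · rw [monomial_succR, sub_neg_eq_add]
      · rw [hk', hk, hx.succR_eq hl, neg_smul, sub_neg_eq_add]
    · refine hcongr ((sN w hw).add_smul hw (-Complex.I)) (fun p => ?_) ?_
      · rw [monomial_succT, monomial_succN]
        ring
      · rw [hx.succT_eq hl, neg_smul, sub_eq_add_neg]
    · obtain ⟨k, hk, hk'⟩ := hN.closure_apply w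
      refine hcongr (SpectralMeasure.Represents.of_resolvent (k := k) hI measurable_snd
        (measurable_monomial w) hE.2 hdN (φ := monomial w.succT) (monomial_succT w)
        (hcongr hw (fun _ => rfl) ?_)) (fun _ => rfl) hk.symm
      rw [hk', hk, hx.succT_eq hl]
  intro w
  obtain ⟨h1, h2⟩ := (main w).inner_eq
  refine ⟨h1, ?_⟩
  rw [h2, hx.gram, Index.pair_zero]

end Model

end ExtMoment

theorem theorem2p2 (u : Index → ℂ) :
    ((∃ μ : Measure (ℝ × ℝ), IsSolution u μ) ↔ IsPositive u ∧ LinearRelations u) ∧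
    (IsPositive u → LinearRelations u →
      (∃! μ : Measure (ℝ × ℝ), IsSolution u μ) ∧
      (∃ (H : Type) (_ : NormedAddCommGroup H) (_ : InnerProductSpace ℂ H) (_ : CompleteSpace H)
        (_ : TopologicalSpace.SeparableSpace H) (x : Index → H), IsModel u x) ∧
      ∀ (H : Type*) [NormedAddCommGroup H] [InnerProductSpace ℂ H] [CompleteSpace H]
        (x : Index → H), IsModel u x →
        IsWellDefinedShift x Index.succM ∧
        IsWellDefinedShift x Index.succN ∧
        IsEssentiallySelfAdjoint (shiftOperator x Index.succM) ∧
        IsEssentiallySelfAdjoint (shiftOperator x Index.succN) ∧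
        StronglyCommute (shiftOperator x Index.succM).closure
          (shiftOperator x Index.succN).closure ∧
        (∃ E : SpectralMeasure (ℝ × ℝ) H, E.IsJoint (shiftOperator x Index.succM).closure
          (shiftOperator x Index.succN).closure) ∧
        ∀ E : SpectralMeasure (ℝ × ℝ) H, E.IsJoint (shiftOperator x Index.succM).closure
          (shiftOperator x Index.succN).closure →
          ∀ μ : Measure (ℝ × ℝ), IsSolution u μ ↔ μ = E.scalarMeasure (x Index.zero)) := by
  refine ⟨⟨fun ⟨μ, hμ⟩ => ⟨hμ.isPositive, hμ.linearRelations⟩,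
    fun ⟨hp, hl⟩ => exists_isSolution hp hl⟩, fun hp hl => ?_⟩
  obtain ⟨μ, hμ⟩ := exists_isSolution hp hl
  refine ⟨⟨μ, hμ, fun ν hν => hν.unique hμ⟩, ?_, ?_⟩
  · have := hμ.isFiniteMeasure
    have : Fact ((2 : ENNReal) ≠ ⊤) := ⟨by simp⟩
    exact ⟨Lp ℂ 2 μ, inferInstance, inferInstance, inferInstance, inferInstance, _, hμ.isModel⟩
  · intro H _ _ _ x hx
    obtain ⟨W, hW⟩ := hx.exists_unitary hμ
    have hW' : ∀ w, W (x w) =ᵐ[μ] monomial w := fun w => by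
      rw [hW]
      exact MemLp.coeFn_toLp _
    have hM := isWellDefinedShift hW' monomial_succM
    have hN := isWellDefinedShift hW' monomial_succN
    have hgM := graph_closure_shiftOperator hx.dense_span measurable_fst hW' monomial_succM
      exists_monomial_eq_fst
    have hgN := graph_closure_shiftOperator hx.dense_span measurable_snd hW' monomial_succN
      exists_monomial_eq_snd
    refine ⟨hM, hN,
      isEssentiallySelfAdjoint_shiftOperator hx.dense_span measurable_fst hW' monomial_succM
        exists_monomial_eq_fst,
      isEssentiallySelfAdjoint_shiftOperator hx.dense_span measurable_snd hW' monomial_succN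
        exists_monomial_eq_snd,
      stronglyCommute_of_graph measurable_fst measurable_snd hgM hgN,
      ⟨transSpectral W, isIntegral_transSpectral hgM measurable_fst,
        isIntegral_transSpectral hgN measurable_snd⟩, fun E hE ν => ?_⟩
    have hs := isSolution_of_isJoint hx hl hM hN hE
    exact ⟨fun hν => hν.unique hs, fun hν => hν ▸ hs⟩
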